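/- Let $U\subset(-2\pi,2\pi)$ be an open set containing $0$, let $\beta\ge 0$, and for $n\ge1$ let $R_n:U\to\mathbb C^{2\times2}$. Put $$B_n(\varepsilon)=\exp\Bigl(-\beta\int_n^{n+1}\frac{\cos(\varepsilon r)}{r}\,dr\Bigr)\left[I+\frac{\beta}{n}\begin{pmatrix}\cos(\varepsilon n)&\sin(\varepsilon n)\\ \sin(\varepsilon n)&-\cos(\varepsilon n)\end{pmatrix}+R_n(\varepsilon)\right],\qquad n\ge1,\ \varepsilon\in U,$$ and for $f\in\mathbb C^2$ let $u_1(\varepsilon,f)=f$, $u_{n+1}(\varepsilon,f)=B_n(\varepsilon)u_n(\varepsilon,f)$ for $n\ge1$. Assume that every $R_n$ is continuous on $U$, that $B_n(\varepsilon)$ is invertible for all $n\ge1$ and $\varepsilon\in U$, and that there are $r_n>0$ with $\sum_n r_n<\infty$ and $\|R_n(\varepsilon)\|<r_n$ for all $n\ge1$, $\varepsilon\in U$. Then $\lim_{n\to\infty}u_n(\varepsilon,f)$ exists for all $\varepsilon\in U$ and $f\in\mathbb C^2$. For every $y>0$ and $f\in\mathbb C^2$ the two limits $$h_\pm(y,f)=\lim_{\varepsilon\to\pm0}u_{\lfloor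 y/|\varepsilon|\rfloor}(\varepsilon,f)$$ exist, and they satisfy the integral equations (with convergent integrals) $$h_\pm(y,f)=\lim_{n\to\infty}u_n(0,f)\pm\int_0^y\begin{pmatrix}0&1\\ \exp\bigl(-2\beta\int_t^y\frac{\cos s}{s}\,ds\bigr)&0\end{pmatrix}\frac{\beta\sin t}{t}\,h_\pm(t,f)\,dt,\qquad y>0.$$ Moreover, for every $f\in\mathbb C^2$ and for each of the two signs, both of the following limits exist and $$\lim_{\varepsilon\to\pm0}\ \lim_{n\to\infty}u_n(\varepsilon,f)=\lim_{y\to+\infty}h_\pm(y,f).$$ Finally, the map $\Theta:f\mapsto\lim_{n\to\infty}u_n(0,f)$ is linear and, if $\beta>0$, it has rank one. -/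

import Mathlib

open Filter Topology MeasureTheory

noncomputable section

/-- `2 × 2` complex matrices. -/
abbrev Mat2 : Type := Matrix (Fin 2) (Fin 2) ℂ

/-- The space of initial data, `ℂ²`. -/
abbrev Vec2 : Type := Fin 2 → ℂ

open scoped Matrix.Norms.L2Operator in
/-- Uniform summability on a set `S`, written `{R_n(ε)}_{n ≥ 1} ∈ l¹(S)`: there is a summable
sequence of positive numbers `r_n` with `‖R_n(ε)‖ < r_n` for all `n ≥ 1` and `ε ∈ S`. The norm is
the operator norm for the Euclidean norm of `ℂ²`. The value at index `0` plays no role. -/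
def UniformlySummableOn (R : ℕ → ℝ → Mat2) (S : Set ℝ) : Prop :=
  ∃ r : ℕ → ℝ, (∀ n, 0 < r n) ∧ Summable r ∧ ∀ n : ℕ, 1 ≤ n → ∀ ε ∈ S, ‖R n ε‖ < r n

/-- The coefficient matrix `B_n(ε)` of the model system; it is used for `n ≥ 1` only. -/
def modelMatrix (β : ℝ) (R : ℕ → ℝ → Mat2) (n : ℕ) (ε : ℝ) : Mat2 :=
  ((Real.exp (-β * ∫ r in (n : ℝ)..((n : ℝ) + 1), Real.cos (ε * r) / r) : ℝ) : ℂ) •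
    ((1 : Mat2) +
      ((β / (n : ℝ) : ℝ) : ℂ) •
        !![((Real.cos (ε * n) : ℝ) : ℂ), ((Real.sin (ε * n) : ℝ) : ℂ);
           ((Real.sin (ε * n) : ℝ) : ℂ), ((-Real.cos (ε * n) : ℝ) : ℂ)] +
      R n ε)

/-- The solution `u_n(ε, f)`, `n ≥ 1`: `u_1 = f` and `u_{n+1} = B_n(ε) u_n`. The sequence
starts at index `1`; the value at index `0` is a placeholder. -/
def modelSol (β : ℝ) (R : ℕ → ℝ → Mat2) (ε : ℝ) (f : Vec2) : ℕ → Vec2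
  | 0 => 0
  | 1 => f
  | n + 2 => (modelMatrix β R (n + 1) ε).mulVec (modelSol β R ε f (n + 1))

/-- The Volterra kernel
`[[0, 1], [exp (-2 β ∫_t^y cos s / s ds), 0]] · (β sin t / t)`, for `0 < t ≤ y`. -/
def slowKernel (β y t : ℝ) : Mat2 :=
  ((β * Real.sin t / t : ℝ) : ℂ) •
    !![0, 1; ((Real.exp (-2 * β * ∫ s in t..y, Real.cos s / s) : ℝ) : ℂ), 0]

/-- `h` satisfies, for every `y > 0`, the integral equation
`h(y) = c + σ ∫_0^y K(y, t) h(t) dt` with `K` the kernel above, the integral being convergent.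
Only the values of `h` on `(0, ∞)` matter. -/
def SolvesSlowEquation (β σ : ℝ) (c : Vec2) (h : ℝ → Vec2) : Prop :=
  ∀ y : ℝ, 0 < y →
    IntervalIntegrable (fun t => (slowKernel β y t).mulVec (h t)) volume 0 y ∧
      h y = c + σ • ∫ t in (0 : ℝ)..y, (slowKernel β y t).mulVec (h t)

end

/-!
The argument splits the evolution at the index `y / |ε|`.

*Slow scale.* For `|ε| n ≤ Y`, the matrix `modelMatrix β R n ε` is `comparisonMatrix β n ε`
plus a remainder of size `1 / n² + r n`, uniformly in `ε` (`norm_stepRemainder_le`). The comparison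
matrix does not move the first component, multiplies the second by
`exp (-2 β ∫_n^{n+1} cos (ε r) / r dr)`, and couples the two by terms `O (|ε|)`, of which there are
`Y / |ε|`. Solutions are therefore bounded (`norm_modelSol_le`). Variation of constants
(`scaleSnd_modelSol_eq`) expresses `u_N` as an integral of the slow kernel against the solution,
plus a sum of remainders. By dominated convergence that sum tends to a vector `slowConst β R f`
whenever `ε → 0`, `N → ∞` and `|ε| N` stays bounded (`ModelHyp.tendsto_sum_stepRemainder`). With
`ε = 0` identically this gives `lim_n u_n(0, f) = slowConst β R f`; on the scale `t = |ε| r` it says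
that `y ↦ u_⌊y / |ε|⌋` solves the Volterra equation up to an error that is bounded and tends to zero
pointwise. Approximate solutions of this kind converge to a solution (`exists_volterra_limit`): the
upper limit of the distance of two of them satisfies the homogeneous Volterra inequality, by the
reverse Fatou lemma, hence vanishes.

*Beyond the slow scale.* For `ε ≠ 0`, the non-summable part of `modelMatrix β R n ε - 1` is, up to
`O (1 / (|ε| n²))`, an exact difference of matrices `corrector β ε n` of size `1 / (|ε| n)` (Abel
summation and partial integration). In the variables `(1 - corrector β ε n) u_n` the system is a
summable perturbation of the identity, so from `n = y / |ε|` on the solution changes by `O (1 / y)`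
plus a tail of `∑ r n` (`ModelHyp.exists_norm_sub_le`). This yields convergence in `n` and the
interchange of the limits `ε → 0` and `y → ∞`.

*Rank.* When `β > 0` the second component of `lim_n u_n(0, f)` is zero, since the factors of that
component multiply to `0`. Because the step matrices are invertible, some `f` is carried to `(1, 0)`
at a late index, after which the first component stays close to `1`.
-/

/-! ### Oscillatory integrals and elementary inequalities -/

noncomputable section

/-- The oscillating logarithm `∫_a^b cos (ε s) / s ds`, used for `0 < a` and `0 < b` only. -/
def cosIntegral (ε a b : ℝ) : ℝ := ∫ s in a..b, Real.cos (ε * s) / s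

theorem pos_of_mem_uIcc {a b s : ℝ} (ha : 0 < a) (hb : 0 < b) (hs : s ∈ Set.uIcc a b) : 0 < s :=
  lt_of_lt_of_le (lt_min ha hb) hs.1

theorem intervalIntegrable_cos_div (ε : ℝ) {a b : ℝ} (ha : 0 < a) (hb : 0 < b) :
    IntervalIntegrable (fun s => Real.cos (ε * s) / s) volume a b := by
  apply ContinuousOn.intervalIntegrable
  intro s hs
  have := pos_of_mem_uIcc ha hb hs
  exact ContinuousAt.continuousWithinAt (by fun_prop (disch := positivity))

theorem cosIntegral_add (ε : ℝ) {a b c : ℝ} (ha : 0 < a) (hb : 0 < b) (hc : 0 < c) :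
    cosIntegral ε a b + cosIntegral ε b c = cosIntegral ε a c :=
  intervalIntegral.integral_add_adjacent_intervals (intervalIntegrable_cos_div ε ha hb)
    (intervalIntegrable_cos_div ε hb hc)

theorem abs_cosIntegral_le (ε : ℝ) {a b : ℝ} (ha : 0 < a) (hab : a ≤ b) :
    |cosIntegral ε a b| ≤ (b - a) / a := by
  have h := intervalIntegral.norm_integral_le_of_norm_le_const (a := a) (b := b) (C := 1 / a)
    (f := fun s => Real.cos (ε * s) / s) (by
      intro s hs
      rw [Set.uIoc_of_le hab] at hs
      have hs0 : 0 < s := ha.trans hs.1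
      rw [Real.norm_eq_abs, abs_div, abs_of_pos hs0]
      exact div_le_div₀ zero_le_one (Real.abs_cos_le_one _) ha hs.1.le)
  rw [abs_of_nonneg (sub_nonneg.2 hab)] at h
  calc _ ≤ 1 / a * (b - a) := h
    _ = _ := by ring

/-- The lower bound comes from `cos x ≥ 1 - x² / 2`. -/
theorem log_sub_le_cosIntegral (ε : ℝ) {a b : ℝ} (ha : 0 < a) (hab : a ≤ b) :
    Real.log (b / a) - ε ^ 2 * (b ^ 2 - a ^ 2) / 4 ≤ cosIntegral ε a b := by
  have hb : 0 < b := ha.trans_le hab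
  have hi : IntervalIntegrable (fun s : ℝ => s⁻¹) volume a b := by
    apply ContinuousOn.intervalIntegrable
    intro s hs
    have := pos_of_mem_uIcc ha hb hs
    exact ContinuousAt.continuousWithinAt (by fun_prop (disch := positivity))
  have hi2 : IntervalIntegrable (fun s : ℝ => ε ^ 2 / 2 * s) volume a b :=
    (by fun_prop : Continuous (fun s : ℝ => ε ^ 2 / 2 * s)).intervalIntegrable _ _
  have h1 : ∫ s in a..b, (s⁻¹ - ε ^ 2 / 2 * s) =
      Real.log (b / a) - ε ^ 2 * (b ^ 2 - a ^ 2) / 4 := by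
    rw [intervalIntegral.integral_sub hi hi2, integral_inv_of_pos ha hb,
      intervalIntegral.integral_const_mul, integral_id]
    ring
  rw [← h1]
  apply intervalIntegral.integral_mono_on hab (hi.sub hi2) (intervalIntegrable_cos_div ε ha hb)
  intro s hs
  have hs0 : 0 < s := ha.trans_le hs.1
  rw [le_div_iff₀ hs0]
  have := Real.one_sub_sq_div_two_le_cos (x := ε * s)
  calc _ = 1 - (ε * s) ^ 2 / 2 := by field_simp
    _ ≤ _ := this

theorem neg_le_cosIntegral (ε : ℝ) {a b : ℝ} (ha : 0 < a) (hab : a ≤ b) :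
    -(ε ^ 2 * (b ^ 2 - a ^ 2) / 4) ≤ cosIntegral ε a b := by
  have h := log_sub_le_cosIntegral ε ha hab
  have : 0 ≤ Real.log (b / a) := Real.log_nonneg ((one_le_div ha).2 hab)
  linarith

theorem hasDerivAt_cosIntegral_left (ε : ℝ) {r x : ℝ} (hr : 0 < r) (hx : 0 < x) :
    HasDerivAt (fun r => cosIntegral ε r x) (-(Real.cos (ε * r) / r)) r := by
  apply intervalIntegral.integral_hasDerivAt_left (intervalIntegrable_cos_div ε hr hx)
  · refine ContinuousAt.stronglyMeasurableAtFilter (s := Set.Ioi 0) isOpen_Ioi ?_ r hr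
    intro s hs
    have : (0 : ℝ) < s := hs
    fun_prop (disch := positivity)
  · fun_prop (disch := positivity)

theorem continuousOn_cosIntegral_left (ε : ℝ) {x : ℝ} (hx : 0 < x) :
    ContinuousOn (fun r => cosIntegral ε r x) (Set.Ioi 0) := fun _ hr =>
  (hasDerivAt_cosIntegral_left ε hr hx).continuousAt.continuousWithinAt

/-- Differences of `trig (ε r) / r` over one unit, for a `1`-Lipschitz `trig` bounded by `1`. -/
theorem abs_comp_div_sub_le {g : ℝ → ℝ} (hL : ∀ x y, |g x - g y| ≤ |x - y|) (hg : ∀ x, |g x| ≤ 1)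
    (ε : ℝ) {a r : ℝ} (ha : 0 < a) (h1 : a ≤ r) (h2 : r ≤ a + 1) :
    |g (ε * r) / r - g (ε * a) / a| ≤ |ε| / a + 1 / a ^ 2 := by
  have hr : 0 < r := ha.trans_le h1
  have e : g (ε * r) / r - g (ε * a) / a =
      (g (ε * r) - g (ε * a)) / r - g (ε * a) * ((r - a) / (a * r)) := by
    field_simp; ring
  rw [e]
  refine (abs_sub _ _).trans (add_le_add ?_ ?_)
  · rw [abs_div, abs_of_pos hr]
    refine div_le_div₀ (abs_nonneg _) ((hL _ _).trans ?_) ha h1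
    rw [← mul_sub, abs_mul, abs_of_nonneg (sub_nonneg.2 h1)]
    exact mul_le_of_le_one_right (abs_nonneg _) (by linarith)
  · rw [abs_mul, abs_of_nonneg (a := (r - a) / (a * r))
      (div_nonneg (sub_nonneg.2 h1) (by positivity))]
    calc _ ≤ 1 * (1 / a ^ 2) := by
          apply mul_le_mul (hg _) _ (div_nonneg (sub_nonneg.2 h1) (by positivity)) zero_le_one
          apply div_le_div₀ zero_le_one (by linarith) (by positivity)
          nlinarith
      _ = _ := one_mul _

theorem abs_integral_comp_div_sub_le {g : ℝ → ℝ} (hc : Continuous g)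
    (hL : ∀ x y, |g x - g y| ≤ |x - y|) (hg : ∀ x, |g x| ≤ 1) (ε : ℝ) {a : ℝ} (ha : 0 < a) :
    |(∫ r in a..(a + 1), g (ε * r) / r) - g (ε * a) / a| ≤ |ε| / a + 1 / a ^ 2 := by
  have hi : IntervalIntegrable (fun r => g (ε * r) / r) volume a (a + 1) := by
    apply ContinuousOn.intervalIntegrable
    intro s hs
    have := pos_of_mem_uIcc ha (by linarith) hs
    exact ContinuousAt.continuousWithinAt (by fun_prop (disch := positivity))
  have h := intervalIntegral.norm_integral_le_of_norm_le_const (a := a) (b := a + 1)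
    (C := |ε| / a + 1 / a ^ 2)
    (f := fun r => g (ε * r) / r - g (ε * a) / a) (by
      intro r hr
      rw [Set.uIoc_of_le (by linarith)] at hr
      exact abs_comp_div_sub_le hL hg ε ha hr.1.le hr.2)
  rw [intervalIntegral.integral_sub hi (by simp)] at h
  simpa using h

theorem abs_cos_sub_cos_le (x y : ℝ) : |Real.cos x - Real.cos y| ≤ |x - y| := by
  have h := Convex.norm_image_sub_le_of_norm_deriv_le (f := Real.cos) (C := 1) (s := Set.univ)
    (x := y) (y := x) (fun _ _ => Real.differentiableAt_cos)
    (fun z _ => by simpa using Real.abs_sin_le_one z) convex_univ trivial trivial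
  simpa using h

theorem abs_sin_sub_sin_le (x y : ℝ) : |Real.sin x - Real.sin y| ≤ |x - y| := by
  have h := Convex.norm_image_sub_le_of_norm_deriv_le (f := Real.sin) (C := 1) (s := Set.univ)
    (x := y) (y := x) (fun _ _ => Real.differentiableAt_sin)
    (fun z _ => by simpa using Real.abs_cos_le_one z) convex_univ trivial trivial
  simpa using h

theorem abs_cosIntegral_succ_sub_le (ε : ℝ) {a : ℝ} (ha : 0 < a) :
    |cosIntegral ε a (a + 1) - Real.cos (ε * a) / a| ≤ |ε| / a + 1 / a ^ 2 :=
  abs_integral_comp_div_sub_le Real.continuous_cos abs_cos_sub_cos_le Real.abs_cos_le_one ε ha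

theorem abs_sin_mul_div_le (ε r : ℝ) : |Real.sin (ε * r) / r| ≤ |ε| := by
  rcases eq_or_ne r 0 with rfl | hr
  · simp
  rw [abs_div, div_le_iff₀ (abs_pos.2 hr), ← abs_mul]
  exact Real.abs_sin_le_abs

theorem abs_exp_sub_one_sub_le (x : ℝ) : |Real.exp x - 1 - x| ≤ x ^ 2 * Real.exp |x| := by
  have h := Complex.norm_exp_sub_sum_le_norm_mul_exp (x : ℂ) 2
  simp only [Finset.sum_range_succ, Finset.sum_range_zero] at h
  rw [← Real.norm_eq_abs, ← Complex.norm_real]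
  push_cast
  simpa [sub_sub] using h

theorem abs_exp_sub_one_le' (x : ℝ) : |Real.exp x - 1| ≤ |x| * Real.exp |x| := by
  have h := Complex.norm_exp_sub_sum_le_norm_mul_exp (x : ℂ) 1
  rw [← Real.norm_eq_abs, ← Complex.norm_real]
  push_cast
  simpa using h

theorem sum_Ico_inv_sq_le {N n : ℕ} (hN : 1 ≤ N) :
    ∑ m ∈ Finset.Ico N n, 1 / (m : ℝ) ^ 2 ≤ (2 : ℝ) / N := by
  obtain ⟨k, rfl⟩ : ∃ k, N = k + 1 := ⟨N - 1, by omega⟩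
  have h := sum_Ioo_inv_sq_le (α := ℝ) k n
  have e : Finset.Ico (k + 1) n = Finset.Ioo k n := by ext; simp
  rw [e]
  simpa [one_div] using h

/-- Discrete Grönwall inequality in the form of a product bound. -/
theorem le_exp_sum_mul {a η : ℕ → ℝ} {N n : ℕ} (hn : N ≤ n)
    (h : ∀ m, N ≤ m → m < n → a (m + 1) ≤ Real.exp (η m) * a m) :
    a n ≤ Real.exp (∑ m ∈ Finset.Ico N n, η m) * a N := by
  induction n, hn using Nat.le_induction with
  | base => simp
  | succ n hn ih =>
    rw [Finset.sum_Ico_succ_top hn, Real.exp_add]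
    have h1 := ih fun m hm hm' => h m hm (by omega)
    calc _ ≤ Real.exp (η n) * a n := h n hn (by omega)
      _ ≤ Real.exp (η n) * (Real.exp (∑ m ∈ Finset.Ico N n, η m) * a N) := by gcongr
      _ = _ := by ring

end

/-! ### The comparison matrix -/

noncomputable section

theorem norm_entry_le_of_l2 {A : Mat2} {c : ℝ}
    (h : (open scoped Matrix.Norms.L2Operator in ‖A‖ < c)) (i j : Fin 2) : ‖A i j‖ ≤ c := by
  have h1 : (open scoped Matrix.Norms.L2Operator in ‖A i j‖ ≤ ‖A‖) := by
    open scoped Matrix.Norms.L2Operator in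
    have h2 := Matrix.l2_opNorm_mulVec A (EuclideanSpace.single j (1 : ℂ))
    have h3 := PiLp.norm_apply_le (WithLp.toLp 2 (A.mulVec (EuclideanSpace.single j (1 : ℂ)))) i
    simp at h2 h3
    exact h3.trans h2
  exact h1.trans h.le

open scoped Matrix.Norms.Operator

theorem norm_le_of_rows {A : Mat2} {c : ℝ} (h : ∀ i, ‖A i 0‖ + ‖A i 1‖ ≤ c) : ‖A‖ ≤ c := by
  have hc : 0 ≤ c := le_trans (by positivity) (h 0)
  lift c to NNReal using hc
  rw [Matrix.linfty_opNorm_def]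
  norm_cast
  refine Finset.sup_le fun i _ => ?_
  rw [← NNReal.coe_le_coe]
  simpa using h i

theorem norm_le_of_entries {A : Mat2} {c : ℝ} (h : ∀ i j, ‖A i j‖ ≤ c) : ‖A‖ ≤ 2 * c :=
  norm_le_of_rows fun i => by linarith [h i 0, h i 1]

/-- The scalar prefactor `exp (-β ∫_n^{n+1} cos (ε r) / r dr)` of `modelMatrix`. -/
def stepFactor (β : ℝ) (n : ℕ) (ε : ℝ) : ℝ := Real.exp (-β * cosIntegral ε n (n + 1))

/-- The matrix with which `modelMatrix β R n ε` is compared. It is chosen so that its entries are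
integrals over `[n, n + 1]`, which makes the variation-of-constants formula
`scaleSnd_modelSol_eq` exact, with an integral in place of a Riemann sum. -/
def comparisonMatrix (β : ℝ) (n : ℕ) (ε : ℝ) : Mat2 :=
  !![1, ((∫ r in (n : ℝ)..(n + 1), β * (Real.sin (ε * r) / r) : ℝ) : ℂ);
     ((∫ r in (n : ℝ)..(n + 1), Real.exp (-2 * β * cosIntegral ε r (n + 1)) *
        (β * (Real.sin (ε * r) / r)) : ℝ) : ℂ),
     ((Real.exp (-2 * β * cosIntegral ε n (n + 1)) : ℝ) : ℂ)]

/-- The part of `modelMatrix` that is summable in `n`, uniformly along `|ε| n ≤ Y`. -/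
def stepRemainder (β : ℝ) (R : ℕ → ℝ → Mat2) (n : ℕ) (ε : ℝ) : Mat2 :=
  modelMatrix β R n ε - comparisonMatrix β n ε

theorem modelMatrix_eq (β : ℝ) (R : ℕ → ℝ → Mat2) (n : ℕ) (ε : ℝ) : modelMatrix β R n ε =
    !![((stepFactor β n ε * (1 + β * (Real.cos (ε * n) / n)) : ℝ) : ℂ),
       ((stepFactor β n ε * (β * (Real.sin (ε * n) / n)) : ℝ) : ℂ);
       ((stepFactor β n ε * (β * (Real.sin (ε * n) / n)) : ℝ) : ℂ),
       ((stepFactor β n ε * (1 - β * (Real.cos (ε * n) / n)) : ℝ) : ℂ)] +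
      ((stepFactor β n ε : ℝ) : ℂ) • R n ε := by
  unfold modelMatrix stepFactor cosIntegral
  rw [smul_add]
  congr 1
  ext i j
  fin_cases i <;> fin_cases j <;> simp <;> ring

theorem abs_cosIntegral_succ_le (ε : ℝ) {n : ℕ} (hn : 1 ≤ n) :
    |cosIntegral ε n (n + 1)| ≤ 1 / n := by
  have h0 : (0 : ℝ) < n := by exact_mod_cast hn
  have := abs_cosIntegral_le ε h0 (b := n + 1) (by linarith)
  simpa using this

theorem stepFactor_le {β : ℝ} (hβ : 0 ≤ β) (ε : ℝ) {n : ℕ} (hn : 1 ≤ n) :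
    stepFactor β n ε ≤ Real.exp β := by
  have h0 : (1 : ℝ) ≤ n := by exact_mod_cast hn
  have h := abs_cosIntegral_succ_le ε hn
  have h1 : 1 / (n : ℝ) ≤ 1 := by rw [div_le_one (by linarith)]; exact h0
  apply Real.exp_le_exp.2
  have := (abs_le.1 (h.trans h1)).1
  nlinarith

theorem stepFactor_pos (β : ℝ) (n : ℕ) (ε : ℝ) : 0 < stepFactor β n ε := Real.exp_pos _

theorem abs_stepFactor_sub_one_le {β : ℝ} (hβ : 0 ≤ β) (ε : ℝ) {n : ℕ} (hn : 1 ≤ n) :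
    |stepFactor β n ε - 1| ≤ β * Real.exp β / n := by
  have h0 : (1 : ℝ) ≤ n := by exact_mod_cast hn
  have h := abs_cosIntegral_succ_le ε hn
  have h1 : 1 / (n : ℝ) ≤ 1 := by rw [div_le_one (by linarith)]; exact h0
  have e : |-β * cosIntegral ε n (n + 1)| = β * |cosIntegral ε n (n + 1)| := by
    rw [abs_mul, abs_neg, abs_of_nonneg hβ]
  refine (abs_exp_sub_one_le' _).trans ?_
  rw [e]
  calc β * |cosIntegral ε n (n + 1)| * Real.exp (β * |cosIntegral ε n (n + 1)|)
      ≤ β * (1 / n) * Real.exp (β * 1) := by gcongr; exact h.trans h1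
    _ = _ := by rw [mul_one]; ring

theorem abs_stepFactor_sub_le {β : ℝ} (hβ : 0 ≤ β) (ε : ℝ) {n : ℕ} (hn : 1 ≤ n) :
    |stepFactor β n ε - 1 + β * cosIntegral ε n (n + 1)| ≤ β ^ 2 * Real.exp β / n ^ 2 := by
  have h0 : (1 : ℝ) ≤ n := by exact_mod_cast hn
  have h := abs_cosIntegral_succ_le ε hn
  have h1 : 1 / (n : ℝ) ≤ 1 := by rw [div_le_one (by linarith)]; exact h0
  have e : |-β * cosIntegral ε n (n + 1)| = β * |cosIntegral ε n (n + 1)| := by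
    rw [abs_mul, abs_neg, abs_of_nonneg hβ]
  have h2 := abs_exp_sub_one_sub_le (-β * cosIntegral ε n (n + 1))
  rw [e, ← sq_abs, e] at h2
  calc _ = |Real.exp (-β * cosIntegral ε n (n + 1)) - 1 - -β * cosIntegral ε n (n + 1)| := by
        unfold stepFactor; congr 1; ring
    _ ≤ _ := h2
    _ ≤ (β * (1 / n)) ^ 2 * Real.exp (β * 1) := by gcongr; exact h.trans h1
    _ = _ := by rw [mul_one]; field_simp

/-- The diagonal entries of the residual (apart from `R n ε`), with `b = ± β`. -/
theorem abs_exp_mul_one_add_sub_le {β b x d K m : ℝ} (hb : |b| = β) (hm : 1 ≤ m)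
    (hx : |x| ≤ 1 / m) (hxd : |x - d| ≤ K / m ^ 2) :
    |1 + b * d - Real.exp (b * x)| ≤ (β * K + β ^ 2 * Real.exp β) / m ^ 2 := by
  have hβ : 0 ≤ β := hb ▸ abs_nonneg b
  have h1 : 1 / m ≤ 1 := by rw [div_le_one (by linarith)]; exact hm
  have e : |b * x| = β * |x| := by rw [abs_mul, hb]
  have h2 := abs_exp_sub_one_sub_le (b * x)
  rw [e, ← sq_abs, e] at h2
  calc _ = |b * (d - x) - (Real.exp (b * x) - 1 - b * x)| := by congr 1; ring
    _ ≤ |b * (d - x)| + |Real.exp (b * x) - 1 - b * x| := abs_sub _ _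
    _ ≤ β * (K / m ^ 2) + (β * (1 / m)) ^ 2 * Real.exp (β * 1) := by
        apply add_le_add
        · rw [abs_mul, hb, abs_sub_comm]; gcongr
        · refine h2.trans ?_
          gcongr
          exact hx.trans h1
    _ = _ := by rw [mul_one]; field_simp

theorem intervalIntegrable_sin_div (ε : ℝ) {a b : ℝ} (ha : 0 < a) (hb : 0 < b) :
    IntervalIntegrable (fun s => Real.sin (ε * s) / s) volume a b := by
  apply ContinuousOn.intervalIntegrable
  intro s hs
  have := pos_of_mem_uIcc ha hb hs
  exact ContinuousAt.continuousWithinAt (by fun_prop (disch := positivity))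

theorem abs_comparison_upper_le {β : ℝ} (hβ : 0 ≤ β) (ε : ℝ) (n : ℕ) :
    |∫ r in (n : ℝ)..(n + 1), β * (Real.sin (ε * r) / r)| ≤ β * |ε| := by
  have h := intervalIntegral.norm_integral_le_of_norm_le_const (a := (n : ℝ)) (b := n + 1)
    (C := β * |ε|) (f := fun r => β * (Real.sin (ε * r) / r)) (by
      intro r _
      rw [Real.norm_eq_abs, abs_mul, abs_of_nonneg hβ]
      exact mul_le_mul_of_nonneg_left (abs_sin_mul_div_le _ _) hβ)
  simpa using h

theorem continuousOn_weight (β ε : ℝ) {x : ℝ} (hx : 0 < x) :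
    ContinuousOn (fun r => Real.exp (-2 * β * cosIntegral ε r x)) (Set.Ioi 0) :=
  Real.continuous_exp.comp_continuousOn
    (continuousOn_const.mul (continuousOn_cosIntegral_left ε hx))

theorem continuousOn_weight_mul_sin (β ε : ℝ) {x : ℝ} (hx : 0 < x) :
    ContinuousOn (fun r => Real.exp (-2 * β * cosIntegral ε r x) * (β * (Real.sin (ε * r) / r)))
      (Set.Ioi 0) := by
  apply (continuousOn_weight β ε hx).mul
  intro s hs
  have : (0 : ℝ) < s := hs
  exact ContinuousAt.continuousWithinAt (by fun_prop (disch := positivity))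

theorem intervalIntegrable_weight_mul_sin (β ε : ℝ) {a b x : ℝ} (ha : 0 < a) (hb : 0 < b)
    (hx : 0 < x) : IntervalIntegrable
      (fun r => Real.exp (-2 * β * cosIntegral ε r x) * (β * (Real.sin (ε * r) / r)))
      volume a b :=
  ((continuousOn_weight_mul_sin β ε hx).mono
    fun _ hs => pos_of_mem_uIcc ha hb hs).intervalIntegrable

theorem abs_cosIntegral_tail_le (ε : ℝ) {n : ℕ} (hn : 1 ≤ n) {r : ℝ} (h1 : n ≤ r)
    (h2 : r ≤ n + 1) : |cosIntegral ε r (n + 1)| ≤ 1 / n := by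
  have h0 : (1 : ℝ) ≤ n := by exact_mod_cast hn
  exact (abs_cosIntegral_le ε (by linarith) h2).trans
    (div_le_div₀ zero_le_one (by linarith) (by linarith) h1)

theorem weight_le_exp {β : ℝ} (hβ : 0 ≤ β) (ε : ℝ) {n : ℕ} (hn : 1 ≤ n) {r : ℝ} (h1 : n ≤ r)
    (h2 : r ≤ n + 1) : Real.exp (-2 * β * cosIntegral ε r (n + 1)) ≤ Real.exp (2 * β) := by
  have h0 : (1 : ℝ) ≤ n := by exact_mod_cast hn
  have h3 : 1 / (n : ℝ) ≤ 1 := by rw [div_le_one (by linarith)]; exact h0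
  have := (abs_le.1 ((abs_cosIntegral_tail_le ε hn h1 h2).trans h3)).1
  apply Real.exp_le_exp.2
  nlinarith

theorem abs_comparison_lower_le {β : ℝ} (hβ : 0 ≤ β) (ε : ℝ) {n : ℕ} (hn : 1 ≤ n) :
    |∫ r in (n : ℝ)..(n + 1), Real.exp (-2 * β * cosIntegral ε r (n + 1)) *
        (β * (Real.sin (ε * r) / r))| ≤ Real.exp (2 * β) * (β * |ε|) := by
  have h := intervalIntegral.norm_integral_le_of_norm_le_const (a := (n : ℝ)) (b := n + 1)
    (C := Real.exp (2 * β) * (β * |ε|))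
    (f := fun r => Real.exp (-2 * β * cosIntegral ε r (n + 1)) * (β * (Real.sin (ε * r) / r))) (by
      intro r hr
      rw [Set.uIoc_of_le (by linarith)] at hr
      rw [Real.norm_eq_abs, abs_mul, abs_of_pos (Real.exp_pos _), abs_mul, abs_of_nonneg hβ]
      exact mul_le_mul (weight_le_exp hβ ε hn hr.1.le hr.2)
        (mul_le_mul_of_nonneg_left (abs_sin_mul_div_le ε r) hβ) (by positivity)
        (Real.exp_pos _).le)
  simpa using h

theorem abs_comparison_lower_sub_upper_le {β : ℝ} (hβ : 0 ≤ β) (ε : ℝ) {n : ℕ} (hn : 1 ≤ n) :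
    |(∫ r in (n : ℝ)..(n + 1), Real.exp (-2 * β * cosIntegral ε r (n + 1)) *
        (β * (Real.sin (ε * r) / r))) - ∫ r in (n : ℝ)..(n + 1), β * (Real.sin (ε * r) / r)| ≤
      2 * β ^ 2 * Real.exp (2 * β) / n ^ 2 := by
  have h0 : (1 : ℝ) ≤ n := by exact_mod_cast hn
  have h3 : 1 / (n : ℝ) ≤ 1 := by rw [div_le_one (by linarith)]; exact h0
  have hp : (0 : ℝ) < n := by linarith
  have h := intervalIntegral.norm_integral_le_of_norm_le_const (a := (n : ℝ)) (b := n + 1)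
    (C := 2 * β ^ 2 * Real.exp (2 * β) / n ^ 2)
    (f := fun r => Real.exp (-2 * β * cosIntegral ε r (n + 1)) * (β * (Real.sin (ε * r) / r)) -
      β * (Real.sin (ε * r) / r)) (by
      intro r hr
      rw [Set.uIoc_of_le (by linarith)] at hr
      have hr0 : 0 < r := hp.trans hr.1
      have hs : |Real.sin (ε * r) / r| ≤ 1 / n := by
        rw [abs_div, abs_of_pos hr0]
        exact div_le_div₀ zero_le_one (Real.abs_sin_le_one _) hp hr.1.le
      have hc := abs_cosIntegral_tail_le ε hn hr.1.le hr.2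
      have e : |-2 * β * cosIntegral ε r (n + 1)| = 2 * β * |cosIntegral ε r (n + 1)| := by
        rw [abs_mul, abs_mul, abs_of_nonneg hβ]; simp
      have hw := abs_exp_sub_one_le' (-2 * β * cosIntegral ε r (n + 1))
      rw [e] at hw
      rw [← sub_one_mul, Real.norm_eq_abs, abs_mul, abs_mul, abs_of_nonneg hβ]
      calc _ ≤ (2 * β * (1 / n) * Real.exp (2 * β * 1)) * (β * (1 / n)) := by
            gcongr
            refine hw.trans ?_
            gcongr
            exact hc.trans h3
        _ = _ := by rw [mul_one]; field_simp)
  rw [intervalIntegral.integral_sub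
    (intervalIntegrable_weight_mul_sin β ε hp (by linarith) (by linarith))
    ((intervalIntegrable_sin_div ε hp (by linarith)).const_mul β)] at h
  simpa using h

end

/-! ### Bounds along `|ε| n ≤ Y` -/

noncomputable section
open scoped Matrix.Norms.Operator

/-- Along `|ε| n ≤ Y` every error term of size `|ε| / n` is of size `Y / n²`. -/
theorem norm_stepRemainder_le {β : ℝ} (hβ : 0 ≤ β) {Y : ℝ} (hY : 0 ≤ Y) : ∃ C : ℝ, 0 ≤ C ∧
    ∀ (R : ℕ → ℝ → Mat2) (n : ℕ) (ε ρ : ℝ), 1 ≤ n → |ε| * n ≤ Y → (∀ i j, ‖R n ε i j‖ ≤ ρ) →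
      ‖stepRemainder β R n ε‖ ≤ C * (1 / (n : ℝ) ^ 2 + ρ) := by
  set K := Y + 1 with hK
  set E := Real.exp β with hE
  set D := E * (β * K + β ^ 2 * E) + (β ^ 2 * E + β * K + 2 * β ^ 2 * Real.exp (2 * β)) with hD
  have hE0 : 0 < E := Real.exp_pos _
  have hK0 : 0 ≤ K := by positivity
  have hD0 : 0 ≤ D := by positivity
  refine ⟨2 * (D + E), by positivity, ?_⟩
  intro R n ε ρ hn hεn hR
  have hρ : 0 ≤ ρ := (norm_nonneg _).trans (hR 0 0)
  have h1n : (1 : ℝ) ≤ n := by exact_mod_cast hn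
  have hp : (0 : ℝ) < n := by linarith
  have hεY : |ε| / n + 1 / (n : ℝ) ^ 2 ≤ K / n ^ 2 := by
    rw [hK, add_div]
    have : |ε| / n ≤ Y / n ^ 2 := by
      rw [div_le_div_iff₀ hp (by positivity)]
      nlinarith
    linarith
  set c := cosIntegral ε n (n + 1) with hc
  have hc1 : |c| ≤ 1 / n := abs_cosIntegral_succ_le ε hn
  have hcd : |c - Real.cos (ε * n) / n| ≤ K / n ^ 2 :=
    (abs_cosIntegral_succ_sub_le ε hp).trans hεY
  have hsd : |(∫ r in (n : ℝ)..(n + 1), Real.sin (ε * r) / r) - Real.sin (ε * n) / n| ≤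
      K / n ^ 2 :=
    (abs_integral_comp_div_sub_le Real.continuous_sin abs_sin_sub_sin_le Real.abs_sin_le_one ε
      hp).trans hεY
  have hsn : |Real.sin (ε * n) / n| ≤ 1 / n := by
    rw [abs_div, abs_of_pos hp]
    gcongr
    exact Real.abs_sin_le_one _
  have he := stepFactor_le hβ ε hn
  have hee := abs_stepFactor_sub_one_le hβ ε hn
  have hepos := stepFactor_pos β n ε
  have he' : stepFactor β n ε = Real.exp (-β * c) := rfl
  set e := stepFactor β n ε with hedef
  have t1 : 0 ≤ E * (β * K + β ^ 2 * E) / n ^ 2 := by positivity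
  have t2 : 0 ≤ (β ^ 2 * E + β * K + 2 * β ^ 2 * Real.exp (2 * β)) / n ^ 2 := by positivity
  have hDs : D / n ^ 2 = E * (β * K + β ^ 2 * E) / n ^ 2 +
    (β ^ 2 * E + β * K + 2 * β ^ 2 * Real.exp (2 * β)) / n ^ 2 := by rw [hD]; ring
  -- upper left entry
  have h11 : |e * (1 + β * (Real.cos (ε * n) / n)) - 1| ≤ D / n ^ 2 := by
    have h := abs_exp_mul_one_add_sub_le (b := β) (abs_of_nonneg hβ) h1n hc1 hcd
    have e1 : e * (1 + β * (Real.cos (ε * n) / n)) - 1 =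
        e * (1 + β * (Real.cos (ε * n) / n) - Real.exp (β * c)) := by
      have : e * Real.exp (β * c) = 1 := by rw [he', ← Real.exp_add]; simp
      rw [mul_sub, this]
    rw [e1, abs_mul, abs_of_pos hepos]
    calc _ ≤ E * ((β * K + β ^ 2 * E) / n ^ 2) := by gcongr
      _ ≤ _ := by rw [hDs, mul_div_assoc]; linarith
  -- lower right entry
  have h22 : |e * (1 - β * (Real.cos (ε * n) / n)) - Real.exp (-2 * β * c)| ≤ D / n ^ 2 := by
    have h := abs_exp_mul_one_add_sub_le (b := -β) (by rw [abs_neg, abs_of_nonneg hβ]) h1n hc1 hcd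
    have e1 : e * (1 - β * (Real.cos (ε * n) / n)) - Real.exp (-2 * β * c) =
        e * (1 + -β * (Real.cos (ε * n) / n) - Real.exp (-β * c)) := by
      have : e * Real.exp (-β * c) = Real.exp (-2 * β * c) := by
        rw [he', ← Real.exp_add]; congr 1; ring
      rw [← this]; ring
    rw [e1, abs_mul, abs_of_pos hepos]
    calc _ ≤ E * ((β * K + β ^ 2 * E) / n ^ 2) := by gcongr
      _ ≤ _ := by rw [hDs, mul_div_assoc]; linarith
  have h12' : |e * (β * (Real.sin (ε * n) / n)) -
      ∫ r in (n : ℝ)..(n + 1), β * (Real.sin (ε * r) / r)| ≤ (β ^ 2 * E + β * K) / n ^ 2 := by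
    rw [intervalIntegral.integral_const_mul]
    set s := ∫ r in (n : ℝ)..(n + 1), Real.sin (ε * r) / r
    set d := Real.sin (ε * n) / n
    calc |e * (β * d) - β * s| = |(e - 1) * (β * d) - β * (s - d)| := by congr 1; ring
      _ ≤ |(e - 1) * (β * d)| + |β * (s - d)| := abs_sub _ _
      _ ≤ (β * E / n) * (β * (1 / n)) + β * (K / n ^ 2) := by
          rw [abs_mul, abs_mul, abs_mul, abs_of_nonneg hβ]
          gcongr
      _ = _ := by field_simp
  have h12 : |e * (β * (Real.sin (ε * n) / n)) -
      ∫ r in (n : ℝ)..(n + 1), β * (Real.sin (ε * r) / r)| ≤ D / n ^ 2 := by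
    refine h12'.trans ?_
    gcongr
    have : 0 ≤ E * (β * K + β ^ 2 * E) + 2 * β ^ 2 * Real.exp (2 * β) := by positivity
    rw [hD]; linarith
  have h21 : |e * (β * (Real.sin (ε * n) / n)) -
      ∫ r in (n : ℝ)..(n + 1), Real.exp (-2 * β * cosIntegral ε r (n + 1)) *
        (β * (Real.sin (ε * r) / r))| ≤ D / n ^ 2 := by
    have h := abs_comparison_lower_sub_upper_le hβ ε hn
    rw [abs_sub_comm] at h
    refine (abs_sub_le _ _ _).trans ((add_le_add h12' h).trans ?_)
    rw [hDs, ← add_div]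
    linarith
  have key : ∀ i j, ‖stepRemainder β R n ε i j‖ ≤ D / n ^ 2 + E * ρ := by
    have hRe : ∀ i j, ‖(e : ℂ) * R n ε i j‖ ≤ E * ρ := fun i j => by
      rw [norm_mul, Complex.norm_real, Real.norm_eq_abs, abs_of_pos hepos]
      gcongr
      exact hR i j
    have aux : ∀ (x y : ℝ) (z : ℂ), |x - y| ≤ D / n ^ 2 → ‖z‖ ≤ E * ρ →
        ‖(x : ℂ) + z - (y : ℂ)‖ ≤ D / n ^ 2 + E * ρ := fun x y z hxy hz => by
      have : (x : ℂ) + z - y = ((x - y : ℝ) : ℂ) + z := by push_cast; ring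
      rw [this]
      refine (norm_add_le _ _).trans (add_le_add ?_ hz)
      rwa [Complex.norm_real]
    intro i j
    unfold stepRemainder
    rw [modelMatrix_eq]
    fin_cases i <;> fin_cases j
    · have := aux _ 1 _ h11 (hRe 0 0)
      simpa [comparisonMatrix] using this
    · exact aux _ _ _ h12 (hRe 0 1)
    · exact aux _ _ _ h21 (hRe 1 0)
    · exact aux _ _ _ h22 (hRe 1 1)
  refine (norm_le_of_entries key).trans ?_
  have : 0 ≤ D * ρ := by positivity
  have : 0 ≤ E / n ^ 2 := by positivity
  calc 2 * (D / n ^ 2 + E * ρ) ≤ 2 * (D / n ^ 2 + E * ρ + (D * ρ + E / n ^ 2)) := by linarith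
    _ = _ := by ring

theorem norm_comparisonMatrix_le {β : ℝ} (hβ : 0 ≤ β) {Y : ℝ} {n : ℕ} {ε : ℝ} (hn : 1 ≤ n)
    (hεn : |ε| * n ≤ Y) :
    ‖comparisonMatrix β n ε‖ ≤ Real.exp ((2 * β * Y + Real.exp (2 * β) * β) * |ε|) := by
  have h1n : (1 : ℝ) ≤ n := by exact_mod_cast hn
  have hp : (0 : ℝ) < n := by linarith
  have hε := abs_nonneg ε
  have hY : 0 ≤ Y := le_trans (by positivity) hεn
  have hu := abs_comparison_upper_le hβ ε n
  have hl := abs_comparison_lower_le hβ ε hn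
  have hE1 : 1 ≤ Real.exp (2 * β) := Real.one_le_exp (by positivity)
  have hc := neg_le_cosIntegral ε hp (b := n + 1) (by linarith)
  have hc' : -(|ε| * Y) ≤ cosIntegral ε n (n + 1) := by
    refine le_trans (neg_le_neg ?_) hc
    rw [← sq_abs]
    have : |ε| * (|ε| * n) ≤ |ε| * Y := by gcongr
    nlinarith [mul_nonneg hε hε]
  have hQ : Real.exp (-2 * β * cosIntegral ε n (n + 1)) ≤ Real.exp (2 * β * Y * |ε|) := by
    apply Real.exp_le_exp.2
    nlinarith
  rw [add_mul, Real.exp_add]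
  have hb : 0 ≤ β * |ε| := by positivity
  have h1 : 1 ≤ Real.exp (2 * β * Y * |ε|) := Real.one_le_exp (by positivity)
  have h2 := Real.add_one_le_exp (Real.exp (2 * β) * β * |ε|)
  have h3 : Real.exp (2 * β * Y * |ε|) + Real.exp (2 * β) * (β * |ε|) ≤
      Real.exp (2 * β * Y * |ε|) * Real.exp (Real.exp (2 * β) * β * |ε|) := by
    have : 0 ≤ Real.exp (2 * β) * β * |ε| := by positivity
    nlinarith
  apply norm_le_of_rows
  intro i
  fin_cases i
  · simp only [comparisonMatrix, Fin.zero_eta, Matrix.of_apply, Matrix.cons_val_zero,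
      Matrix.cons_val_one, norm_one, Complex.norm_real, Real.norm_eq_abs]
    refine le_trans ?_ h3
    nlinarith
  · simp only [comparisonMatrix, Fin.mk_one, Matrix.of_apply, Matrix.cons_val_zero,
      Matrix.cons_val_one, Complex.norm_real, Real.norm_eq_abs, abs_of_pos (Real.exp_pos _)]
    linarith

/-- Along `|ε| n ≤ Y` the solutions are bounded uniformly in `ε`: the comparison matrices are
contractions up to a factor `exp (C |ε|)`. -/
theorem norm_modelSol_le {β : ℝ} (hβ : 0 ≤ β) {U : Set ℝ} {R : ℕ → ℝ → Mat2} {r : ℕ → ℝ}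
    (hr0 : ∀ n, 0 ≤ r n) (hr : Summable r)
    (hR : ∀ n, 1 ≤ n → ∀ ε ∈ U, ∀ i j, ‖R n ε i j‖ ≤ r n) {Y : ℝ} (hY : 0 ≤ Y) :
    ∃ C : ℝ, 0 ≤ C ∧ ∀ ε ∈ U, ∀ (f : Vec2) (n : ℕ), |ε| * n ≤ Y →
      ‖modelSol β R ε f n‖ ≤ C * ‖f‖ := by
  obtain ⟨C, hC, hS⟩ := norm_stepRemainder_le hβ hY
  set D := 2 * β * Y + Real.exp (2 * β) * β
  have hD : 0 ≤ D := by positivity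
  refine ⟨Real.exp (D * Y + C * (2 + ∑' n, r n)), (Real.exp_pos _).le, ?_⟩
  intro ε hε f n hn
  rcases Nat.eq_zero_or_pos n with rfl | hn1
  · simp only [modelSol, norm_zero]; positivity
  have step : ∀ m, 1 ≤ m → m < n → ‖modelSol β R ε f (m + 1)‖ ≤
      Real.exp (D * |ε| + C * (1 / (m : ℝ) ^ 2 + r m)) * ‖modelSol β R ε f m‖ := by
    intro m hm hmn
    have hmY : |ε| * m ≤ Y := le_trans (by gcongr) hn
    obtain ⟨k, rfl⟩ : ∃ k, m = k + 1 := ⟨m - 1, by omega⟩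
    have e : modelSol β R ε f (k + 1 + 1) =
      (comparisonMatrix β (k + 1) ε + stepRemainder β R (k + 1) ε).mulVec
        (modelSol β R ε f (k + 1)) := by
      simp [modelSol, stepRemainder]
    rw [e]
    refine (Matrix.linfty_opNorm_mulVec _ _).trans ?_
    gcongr
    refine (norm_add_le _ _).trans ?_
    have h1 := norm_comparisonMatrix_le hβ hm hmY
    have h2 := hS R (k + 1) ε (r (k + 1)) hm hmY (hR _ hm ε hε)
    have h3 : 0 ≤ D * |ε| := by positivity
    have h4 := Real.one_le_exp h3
    have h5 := Real.add_one_le_exp (C * (1 / ((k + 1 : ℕ) : ℝ) ^ 2 + r (k + 1)))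
    have h6 : 0 ≤ C * (1 / ((k + 1 : ℕ) : ℝ) ^ 2 + r (k + 1)) :=
      mul_nonneg hC (add_nonneg (by positivity) (hr0 _))
    rw [Real.exp_add]
    nlinarith
  have h := le_exp_sum_mul (a := fun m => ‖modelSol β R ε f m‖)
    (η := fun m => D * |ε| + C * (1 / (m : ℝ) ^ 2 + r m)) hn1 step
  have h1 : modelSol β R ε f 1 = f := by simp [modelSol]
  simp only [h1] at h
  refine h.trans ?_
  gcongr
  rw [Finset.sum_add_distrib, ← Finset.mul_sum (f := fun m : ℕ => 1 / (m : ℝ) ^ 2 + r m),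
    Finset.sum_add_distrib, Finset.sum_const, Nat.card_Ico, nsmul_eq_mul]
  have hs1 := sum_Ico_inv_sq_le (N := 1) (n := n) le_rfl
  have hs2 := hr.sum_le_tsum (Finset.Ico 1 n) (fun i _ => hr0 i)
  have hn' : ((n - 1 : ℕ) : ℝ) ≤ n := by exact_mod_cast Nat.sub_le _ _
  refine add_le_add ?_ ?_
  · calc ((n - 1 : ℕ) : ℝ) * (D * |ε|) ≤ n * (D * |ε|) := by gcongr
      _ = D * (|ε| * n) := by ring
      _ ≤ _ := by gcongr
  · gcongr
    simpa using hs1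

end

/-! ### Variation of constants -/

noncomputable section

/-- The action of the real matrix `[[0, p], [q, 0]]` on `ℂ²`. -/
def antidiagMul (p q : ℝ) (v : Vec2) : Vec2 := ![(p : ℂ) * v 1, (q : ℂ) * v 0]

/-- The action of the real matrix `diag (1, w)` on `ℂ²`. -/
def scaleSnd (w : ℝ) (v : Vec2) : Vec2 := ![v 0, (w : ℂ) * v 1]

@[simp] theorem antidiagMul_zero (p q : ℝ) (v : Vec2) : antidiagMul p q v 0 = p * v 1 := rfl

@[simp] theorem antidiagMul_one (p q : ℝ) (v : Vec2) : antidiagMul p q v 1 = q * v 0 := rfl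

@[simp] theorem scaleSnd_zero (w : ℝ) (v : Vec2) : scaleSnd w v 0 = v 0 := rfl

@[simp] theorem scaleSnd_one (w : ℝ) (v : Vec2) : scaleSnd w v 1 = w * v 1 := rfl

theorem norm_antidiagMul_le {p q M : ℝ} (hp : |p| ≤ M) (hq : |q| ≤ M) (v : Vec2) :
    ‖antidiagMul p q v‖ ≤ M * ‖v‖ := by
  have hM : 0 ≤ M := (abs_nonneg p).trans hp
  rw [pi_norm_le_iff_of_nonneg (by positivity)]
  intro i
  fin_cases i
  · simp only [Fin.zero_eta, antidiagMul_zero, norm_mul, Complex.norm_real]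
    exact mul_le_mul hp (norm_le_pi_norm v 1) (norm_nonneg _) hM
  · simp only [Fin.mk_one, antidiagMul_one, norm_mul, Complex.norm_real]
    exact mul_le_mul hq (norm_le_pi_norm v 0) (norm_nonneg _) hM

theorem norm_scaleSnd_le {w M : ℝ} (h1 : 1 ≤ M) (hw : |w| ≤ M) (v : Vec2) :
    ‖scaleSnd w v‖ ≤ M * ‖v‖ := by
  rw [pi_norm_le_iff_of_nonneg (by positivity)]
  intro i
  fin_cases i
  · simp only [Fin.zero_eta, scaleSnd_zero]
    exact (norm_le_pi_norm v 0).trans (le_mul_of_one_le_left (norm_nonneg _) h1)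
  · simp only [Fin.mk_one, scaleSnd_one, norm_mul, Complex.norm_real]
    exact mul_le_mul hw (norm_le_pi_norm v 1) (norm_nonneg _) (by linarith)

theorem antidiagMul_sub (p q : ℝ) (v w : Vec2) :
    antidiagMul p q v - antidiagMul p q w = antidiagMul p q (v - w) := by
  ext i; fin_cases i <;> simp [mul_sub]

theorem scaleSnd_add (w : ℝ) (v v' : Vec2) :
    scaleSnd w (v + v') = scaleSnd w v + scaleSnd w v' := by
  ext i; fin_cases i <;> simp [mul_add]

theorem intervalIntegral_apply {f : ℝ → Vec2} {a b : ℝ} (hf : IntervalIntegrable f volume a b)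
    (i : Fin 2) : (∫ t in a..b, f t) i = ∫ t in a..b, f t i :=
  ((ContinuousLinearMap.proj (R := ℂ) (φ := fun _ : Fin 2 => ℂ) i).intervalIntegral_comp_comm
    hf).symm

theorem measurable_antidiagMul {p q : ℝ → ℝ} {v : ℝ → Vec2} (hp : Measurable p)
    (hq : Measurable q) (hv : Measurable v) :
    Measurable fun t => antidiagMul (p t) (q t) (v t) := by
  apply measurable_pi_lambda
  intro i
  have h0 : Measurable fun t => v t 0 := (measurable_pi_apply 0).comp hv
  have h1 : Measurable fun t => v t 1 := (measurable_pi_apply 1).comp hv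
  fin_cases i
  · exact (Complex.measurable_ofReal.comp hp).mul h1
  · exact (Complex.measurable_ofReal.comp hq).mul h0

theorem aestronglyMeasurable_antidiagMul {p q : ℝ → ℝ} {v : ℝ → Vec2} {b : ℝ}
    (hp : ContinuousOn p (Set.Ioi 0)) (hq : ContinuousOn q (Set.Ioi 0)) (hv : Measurable v) :
    AEStronglyMeasurable (fun t => antidiagMul (p t) (q t) (v t))
      (volume.restrict (Set.Ioc 0 b)) := by
  have hm : ∀ {g : ℝ → ℝ}, ContinuousOn g (Set.Ioi 0) → Measurable ((Set.Ioi 0).indicator g) :=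
    fun {g} hg => by
      rw [← Set.piecewise_eq_indicator]
      exact hg.measurable_piecewise continuous_zero.continuousOn measurableSet_Ioi
  refine (measurable_antidiagMul (hm hp) (hm hq) hv).aestronglyMeasurable.congr ?_
  filter_upwards [ae_restrict_mem measurableSet_Ioc] with t ht
  rw [Set.indicator_of_mem (show t ∈ Set.Ioi (0 : ℝ) from ht.1),
    Set.indicator_of_mem (show t ∈ Set.Ioi (0 : ℝ) from ht.1)]

theorem intervalIntegrable_antidiagMul {p q : ℝ → ℝ} {v : ℝ → Vec2} {b M C : ℝ} (hb : 0 ≤ b)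
    (hp : ContinuousOn p (Set.Ioi 0)) (hq : ContinuousOn q (Set.Ioi 0)) (hv : Measurable v)
    (hpM : ∀ t ∈ Set.Ioc 0 b, |p t| ≤ M) (hqM : ∀ t ∈ Set.Ioc 0 b, |q t| ≤ M)
    (hvC : ∀ t ∈ Set.Ioc 0 b, ‖v t‖ ≤ C) :
    IntervalIntegrable (fun t => antidiagMul (p t) (q t) (v t)) volume 0 b := by
  rw [intervalIntegrable_iff_integrableOn_Ioc_of_le hb]
  refine Integrable.of_bound (aestronglyMeasurable_antidiagMul hp hq hv) (M * C) ?_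
  filter_upwards [ae_restrict_mem measurableSet_Ioc] with t ht
  have hM : 0 ≤ M := (abs_nonneg _).trans (hpM t ht)
  exact (norm_antidiagMul_le (hpM t ht) (hqM t ht) _).trans
    (mul_le_mul_of_nonneg_left (hvC t ht) hM)

/-- The weight `exp (-2 β ∫_a^x cos (ε s) / s ds)` by which the homogeneous second component is
propagated from `a` to `x`. -/
def weight (β ε a x : ℝ) : ℝ := Real.exp (-2 * β * cosIntegral ε a x)

theorem weight_pos (β ε a x : ℝ) : 0 < weight β ε a x := Real.exp_pos _

theorem weight_mul (β ε : ℝ) {a b c : ℝ} (ha : 0 < a) (hb : 0 < b) (hc : 0 < c) :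
    weight β ε a b * weight β ε b c = weight β ε a c := by
  unfold weight
  rw [← Real.exp_add, ← cosIntegral_add ε ha hb hc]
  congr 1; ring

theorem weight_le {β : ℝ} (hβ : 0 ≤ β) {ε a x Y : ℝ} (ha : 0 < a) (hax : a ≤ x)
    (hY : |ε| * x ≤ Y) : weight β ε a x ≤ Real.exp (β * Y ^ 2) := by
  apply Real.exp_le_exp.2
  have h := neg_le_cosIntegral ε ha hax
  have hx : 0 < x := ha.trans_le hax
  have h1 : ε ^ 2 * (x ^ 2 - a ^ 2) ≤ Y ^ 2 := by
    calc ε ^ 2 * (x ^ 2 - a ^ 2) ≤ (|ε| * x) ^ 2 := by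
          rw [mul_pow, sq_abs]
          nlinarith [mul_nonneg (sq_nonneg ε) (sq_nonneg a)]
      _ ≤ Y ^ 2 := by gcongr
  have h2 : -(Y ^ 2 / 4) ≤ cosIntegral ε a x := by linarith
  nlinarith [sq_nonneg Y]

/-- The integrand `k (x, r) u_{⌊r⌋}` of the variation-of-constants formula. -/
def drift (β ε x : ℝ) (u : ℕ → Vec2) (r : ℝ) : Vec2 :=
  antidiagMul (β * (Real.sin (ε * r) / r)) (weight β ε r x * (β * (Real.sin (ε * r) / r)))
    (u ⌊r⌋₊)

theorem continuousOn_sin_mul_div (β ε : ℝ) :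
    ContinuousOn (fun r => β * (Real.sin (ε * r) / r)) (Set.Ioi 0) := by
  intro s hs
  have : (0 : ℝ) < s := hs
  exact ContinuousAt.continuousWithinAt (by fun_prop (disch := positivity))

theorem abs_mul_sin_div_le {β : ℝ} (hβ : 0 ≤ β) (ε r : ℝ) :
    |β * (Real.sin (ε * r) / r)| ≤ β * |ε| := by
  rw [abs_mul, abs_of_nonneg hβ]
  exact mul_le_mul_of_nonneg_left (abs_sin_mul_div_le ε r) hβ

theorem norm_drift_le {β : ℝ} (hβ : 0 ≤ β) {ε x Y r : ℝ} (hY : |ε| * x ≤ Y) (hr : 0 < r)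
    (hrx : r ≤ x) (u : ℕ → Vec2) :
    ‖drift β ε x u r‖ ≤ Real.exp (β * Y ^ 2) * (β * |ε|) * ‖u ⌊r⌋₊‖ := by
  have h1 := abs_mul_sin_div_le hβ ε r
  apply norm_antidiagMul_le
  · refine h1.trans (le_mul_of_one_le_left (by positivity) (Real.one_le_exp (by positivity)))
  · rw [abs_mul, abs_of_pos (weight_pos _ _ _ _)]
    exact mul_le_mul (weight_le hβ hr hrx hY) h1 (abs_nonneg _) (Real.exp_pos _).le

theorem intervalIntegrable_drift {β : ℝ} (hβ : 0 ≤ β) (ε : ℝ) {x a b : ℝ} (ha : a ∈ Set.Icc 0 x)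
    (hb : b ∈ Set.Icc 0 x) (u : ℕ → Vec2) :
    IntervalIntegrable (drift β ε x u) volume a b := by
  rcases eq_or_lt_of_le (ha.1.trans ha.2) with hx | hx
  · have e1 : a = 0 := le_antisymm (hx ▸ ha.2) ha.1
    have e2 : b = 0 := le_antisymm (hx ▸ hb.2) hb.1
    rw [e1, e2]
  have h : IntervalIntegrable (drift β ε x u) volume 0 x := by
    apply intervalIntegrable_antidiagMul (M := Real.exp (β * (|ε| * x) ^ 2) * (β * |ε|))
      (C := ∑ m ∈ Finset.range (⌊x⌋₊ + 1), ‖u m‖) hx.le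
      (continuousOn_sin_mul_div β ε) (continuousOn_weight_mul_sin β ε hx)
      ((measurable_from_nat (f := u)).comp Nat.measurable_floor)
    · intro t _
      refine (abs_mul_sin_div_le hβ ε t).trans
        (le_mul_of_one_le_left (by positivity) (Real.one_le_exp (by positivity)))
    · intro t ht
      rw [abs_mul, abs_of_pos (Real.exp_pos _)]
      exact mul_le_mul (weight_le hβ ht.1 ht.2 le_rfl) (abs_mul_sin_div_le hβ ε t) (abs_nonneg _)
        (Real.exp_pos _).le
    · intro t ht
      exact Finset.single_le_sum (f := fun m => ‖u m‖) (fun _ _ => norm_nonneg _)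
        (Finset.mem_range.2 (Nat.lt_succ_of_le (Nat.floor_mono ht.2)))
  refine h.mono_set ?_
  rw [Set.uIcc_of_le hx.le]
  exact Set.uIcc_subset_Icc ha hb

theorem integral_drift_succ {β : ℝ} (hβ : 0 ≤ β) (ε : ℝ) {x : ℝ} {n : ℕ} (hn : 1 ≤ n)
    (hx : n + 1 ≤ x) (u : ℕ → Vec2) :
    ∫ r in (n : ℝ)..(n + 1), drift β ε x u r =
      antidiagMul (∫ r in (n : ℝ)..(n + 1), β * (Real.sin (ε * r) / r))
        (∫ r in (n : ℝ)..(n + 1), weight β ε r x * (β * (Real.sin (ε * r) / r))) (u n) := by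
  have hp : (0 : ℝ) < n := by exact_mod_cast hn
  have hi := intervalIntegrable_drift hβ ε (x := x) (a := n) (b := n + 1)
    ⟨hp.le, by linarith⟩ ⟨by linarith, hx⟩ u
  have hcongr : ∀ i, ∫ r in (n : ℝ)..(n + 1), drift β ε x u r i =
      ∫ r in (n : ℝ)..(n + 1), antidiagMul (β * (Real.sin (ε * r) / r))
        (weight β ε r x * (β * (Real.sin (ε * r) / r))) (u n) i := by
    intro i
    apply intervalIntegral.integral_congr_Ioo_of_le (by linarith)
    intro r hr
    have : ⌊r⌋₊ = n := by
      rw [Nat.floor_eq_iff (hp.trans hr.1).le]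
      exact ⟨hr.1.le, hr.2⟩
    simp only [drift, this]
  ext i
  rw [intervalIntegral_apply hi, hcongr]
  fin_cases i
  · simp only [Fin.zero_eta, antidiagMul_zero]
    rw [intervalIntegral.integral_mul_const, intervalIntegral.integral_ofReal]
  · simp only [Fin.mk_one, antidiagMul_one]
    rw [intervalIntegral.integral_mul_const, intervalIntegral.integral_ofReal]

theorem modelSol_succ (β : ℝ) (R : ℕ → ℝ → Mat2) (ε : ℝ) (f : Vec2) {n : ℕ} (hn : 1 ≤ n) :
    modelSol β R ε f (n + 1) = (modelMatrix β R n ε).mulVec (modelSol β R ε f n) := by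
  obtain ⟨k, rfl⟩ : ∃ k, n = k + 1 := ⟨n - 1, by omega⟩
  rfl

theorem scaleSnd_modelSol_succ {β : ℝ} (hβ : 0 ≤ β) (R : ℕ → ℝ → Mat2) (ε : ℝ) (f : Vec2)
    {x : ℝ} {n : ℕ} (hn : 1 ≤ n) (hx : n + 1 ≤ x) :
    scaleSnd (weight β ε (n + 1) x) (modelSol β R ε f (n + 1)) =
      scaleSnd (weight β ε n x) (modelSol β R ε f n) +
      (∫ r in (n : ℝ)..(n + 1), drift β ε x (modelSol β R ε f) r) +
      scaleSnd (weight β ε (n + 1) x)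
        ((stepRemainder β R n ε).mulVec (modelSol β R ε f n)) := by
  have hp : (0 : ℝ) < n := by exact_mod_cast hn
  have e : modelMatrix β R n ε = comparisonMatrix β n ε + stepRemainder β R n ε := by
    simp [stepRemainder]
  rw [modelSol_succ β R ε f hn, e, Matrix.add_mulVec, scaleSnd_add,
    integral_drift_succ hβ ε hn hx]
  congr 1
  have hw : weight β ε (n + 1) x * weight β ε n (n + 1) = weight β ε n x := by
    rw [mul_comm]; exact weight_mul β ε hp (by linarith) (by linarith)
  have hs : weight β ε (n + 1) x * (∫ r in (n : ℝ)..(n + 1),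
      weight β ε r (n + 1) * (β * (Real.sin (ε * r) / r))) =
      ∫ r in (n : ℝ)..(n + 1), weight β ε r x * (β * (Real.sin (ε * r) / r)) := by
    rw [← intervalIntegral.integral_const_mul]
    apply intervalIntegral.integral_congr
    intro r hr
    have hr0 : 0 < r := pos_of_mem_uIcc hp (by linarith) hr
    simp only
    rw [← weight_mul β ε hr0 (b := n + 1) (by linarith) (by linarith : (0 : ℝ) < x)]
    ring
  ext i
  fin_cases i
  · simp [comparisonMatrix, dotProduct, Fin.sum_univ_two]
  · simp only [scaleSnd_one, antidiagMul_one, Fin.mk_one, Pi.add_apply]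
    rw [← hw, ← hs]
    simp only [comparisonMatrix, Matrix.mulVec, dotProduct, Fin.sum_univ_two, Matrix.of_apply,
      Matrix.cons_val_one, Matrix.cons_val_zero, weight]
    push_cast
    ring

/-- Variation of constants. The placeholder value `u_0 = 0` makes the integral over `[0, 1]`
vanish. -/
theorem scaleSnd_modelSol_eq {β : ℝ} (hβ : 0 ≤ β) (R : ℕ → ℝ → Mat2) (ε : ℝ) (f : Vec2)
    {x : ℝ} {N : ℕ} (hN : 1 ≤ N) (hx : N ≤ x) :
    scaleSnd (weight β ε N x) (modelSol β R ε f N) =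
      scaleSnd (weight β ε 1 x) f + (∫ r in (0 : ℝ)..N, drift β ε x (modelSol β R ε f) r) +
      ∑ n ∈ Finset.Ico 1 N, scaleSnd (weight β ε (n + 1) x)
        ((stepRemainder β R n ε).mulVec (modelSol β R ε f n)) := by
  induction N, hN using Nat.le_induction with
  | base =>
    have h0 : ∫ r in (0 : ℝ)..1, drift β ε x (modelSol β R ε f) r = 0 := by
      rw [intervalIntegral.integral_congr_Ioo_of_le (g := fun _ => (0 : Vec2)) zero_le_one]
      · simp
      · intro r hr
        have : ⌊r⌋₊ = 0 := Nat.floor_eq_zero.2 hr.2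
        ext i
        fin_cases i <;> simp [drift, this, modelSol]
    simp [h0, modelSol]
  | succ N hN ih =>
    push_cast at hx
    have hN0 : (0 : ℝ) ≤ N := by positivity
    rw [Finset.sum_Ico_succ_top hN, Nat.cast_succ, scaleSnd_modelSol_succ hβ R ε f hN hx,
      ih (by linarith), ← intervalIntegral.integral_add_adjacent_intervals (b := (N : ℝ))
        (intervalIntegrable_drift hβ ε ⟨le_rfl, by linarith⟩ ⟨hN0, by linarith⟩ _)
        (intervalIntegrable_drift hβ ε ⟨hN0, by linarith⟩ ⟨by linarith, hx⟩ _)]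
    abel

end

/-! ### Dominated convergence as `ε → 0` -/

noncomputable section

/-- The hypotheses on the model system that enter the estimates, with the smallness of `R n ε`
expressed entrywise by a summable majorant `r`. -/
structure ModelHyp (β : ℝ) (U : Set ℝ) (R : ℕ → ℝ → Mat2) (r : ℕ → ℝ) : Prop where
  nonneg : 0 ≤ β
  mem_nhds : U ∈ 𝓝 (0 : ℝ)
  majorant_nonneg : ∀ n, 0 ≤ r n
  summable : Summable r
  entry_le : ∀ n, 1 ≤ n → ∀ ε ∈ U, ∀ i j, ‖R n ε i j‖ ≤ r n
  continuousAt : ∀ n, 1 ≤ n → ContinuousAt (R n) 0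

theorem abs_cosIntegral_sub_zero_le (ε : ℝ) {a b : ℝ} (ha : 0 < a) (hab : a ≤ b) :
    |cosIntegral ε a b - cosIntegral 0 a b| ≤ |ε| * (b - a) := by
  have hb := ha.trans_le hab
  have h := intervalIntegral.norm_integral_le_of_norm_le_const (a := a) (b := b)
    (C := |ε|) (f := fun s => Real.cos (ε * s) / s - Real.cos (0 * s) / s) (by
      intro s hs
      rw [Set.uIoc_of_le hab] at hs
      have hs0 : 0 < s := ha.trans hs.1
      rw [← sub_div, Real.norm_eq_abs, abs_div, abs_of_pos hs0, div_le_iff₀ hs0]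
      refine (abs_cos_sub_cos_le _ _).trans ?_
      rw [zero_mul, sub_zero, abs_mul, abs_of_pos hs0])
  rw [intervalIntegral.integral_sub (intervalIntegrable_cos_div ε ha hb)
    (intervalIntegrable_cos_div 0 ha hb), abs_of_nonneg (sub_nonneg.2 hab)] at h
  exact h

theorem continuousAt_cosIntegral_zero {a b : ℝ} (ha : 0 < a) (hab : a ≤ b) :
    ContinuousAt (fun ε => cosIntegral ε a b) 0 := by
  refine tendsto_iff_norm_sub_tendsto_zero.2 (squeeze_zero (fun _ => norm_nonneg _)
    (fun ε => abs_cosIntegral_sub_zero_le ε ha hab) ?_)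
  have : Continuous fun ε : ℝ => |ε| * (b - a) := by fun_prop
  simpa using this.tendsto 0

theorem continuousAt_stepFactor_zero (β : ℝ) {n : ℕ} (hn : 1 ≤ n) :
    ContinuousAt (stepFactor β n) 0 := by
  have hp : (0 : ℝ) < n := by exact_mod_cast hn
  have h := continuousAt_cosIntegral_zero hp (b := n + 1) (by linarith)
  exact Real.continuous_exp.continuousAt.comp (continuousAt_const.mul h)

theorem continuousAt_modelMatrix_zero {β : ℝ} {R : ℕ → ℝ → Mat2} {n : ℕ} (hn : 1 ≤ n)
    (hR : ContinuousAt (R n) 0) : ContinuousAt (modelMatrix β R n) 0 := by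
  have h := continuousAt_stepFactor_zero β hn
  have hR' : ∀ i j, ContinuousAt (fun ε => R n ε i j) 0 := fun i j =>
    continuousAt_pi.1 (continuousAt_pi.1 hR i) j
  have e : modelMatrix β R n = fun ε => modelMatrix β R n ε := rfl
  rw [e]
  simp only [modelMatrix_eq]
  refine continuousAt_pi.2 fun i => continuousAt_pi.2 fun j => ?_
  have hRij := hR' i j
  fin_cases i <;> fin_cases j <;>
    simp only [Matrix.add_apply, Matrix.smul_apply, Matrix.of_apply, Fin.zero_eta, Fin.mk_one,
      Matrix.cons_val_zero, Matrix.cons_val_one, smul_eq_mul] at hRij ⊢ <;>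
    fun_prop

theorem continuousAt_comparisonMatrix_zero {β : ℝ} (hβ : 0 ≤ β) {n : ℕ} (hn : 1 ≤ n) :
    ContinuousAt (comparisonMatrix β n) 0 := by
  have hp : (0 : ℝ) < n := by exact_mod_cast hn
  have hc := continuousAt_cosIntegral_zero hp (b := n + 1) (by linarith)
  have sq : ∀ {g : ℝ → ℝ} {M : ℝ}, g 0 = 0 → (∀ ε, |g ε| ≤ M * |ε|) → ContinuousAt g 0 := by
    intro g M h0 hg
    rw [ContinuousAt, h0]
    refine squeeze_zero_norm hg ?_
    have : Continuous fun ε : ℝ => M * |ε| := by fun_prop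
    simpa using this.tendsto 0
  have h1 := sq (by simp) fun ε => abs_comparison_upper_le hβ ε n
  have h2 := sq (M := Real.exp (2 * β) * β) (by simp) fun ε =>
    (abs_comparison_lower_le hβ ε hn).trans_eq (mul_assoc _ _ _).symm
  refine continuousAt_pi.2 fun i => continuousAt_pi.2 fun j => ?_
  fin_cases i <;> fin_cases j
  · exact continuousAt_const
  · exact Complex.continuous_ofReal.continuousAt.comp h1
  · exact Complex.continuous_ofReal.continuousAt.comp h2
  · exact Complex.continuous_ofReal.continuousAt.comp
      (Real.continuous_exp.continuousAt.comp (continuousAt_const.mul hc))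

theorem continuousAt_stepRemainder_zero {β : ℝ} (hβ : 0 ≤ β) {R : ℕ → ℝ → Mat2} {n : ℕ}
    (hn : 1 ≤ n) (hR : ContinuousAt (R n) 0) : ContinuousAt (stepRemainder β R n) 0 :=
  (continuousAt_modelMatrix_zero hn hR).sub (continuousAt_comparisonMatrix_zero hβ hn)

theorem continuousAt_mulVec {A : ℝ → Mat2} {v : ℝ → Vec2} (hA : ContinuousAt A 0)
    (hv : ContinuousAt v 0) : ContinuousAt (fun ε => (A ε).mulVec (v ε)) 0 := by
  have : Continuous fun p : Mat2 × Vec2 => p.1.mulVec p.2 :=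
    Continuous.matrix_mulVec continuous_fst continuous_snd
  exact this.continuousAt.comp (f := fun ε => (A ε, v ε)) (hA.prodMk hv)

theorem ModelHyp.continuousAt_modelSol {β : ℝ} {U : Set ℝ} {R : ℕ → ℝ → Mat2} {r : ℕ → ℝ}
    (H : ModelHyp β U R r) (f : Vec2) (n : ℕ) :
    ContinuousAt (fun ε => modelSol β R ε f n) 0 := by
  rcases Nat.eq_zero_or_pos n with rfl | hn
  · exact continuousAt_const
  induction n, hn using Nat.le_induction with
  | base => exact continuousAt_const
  | succ n hn ih =>
    have hn' : 1 ≤ n := hn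
    simp only [modelSol_succ β R _ f hn']
    exact continuousAt_mulVec (continuousAt_modelMatrix_zero hn' (H.continuousAt n hn')) ih

theorem norm_stepRemainder_mulVec_le {β : ℝ} {U : Set ℝ} {R : ℕ → ℝ → Mat2} {r : ℕ → ℝ}
    (H : ModelHyp β U R r) {Y : ℝ} (hY : 0 ≤ Y) : ∃ C : ℝ, 0 ≤ C ∧
    ∀ ε ∈ U, ∀ n : ℕ, 1 ≤ n → |ε| * n ≤ Y → ∀ v : Vec2,
      ‖(stepRemainder β R n ε).mulVec v‖ ≤ C * (1 / (n : ℝ) ^ 2 + r n) * ‖v‖ := by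
  obtain ⟨C, hC, h⟩ := norm_stepRemainder_le H.nonneg hY
  refine ⟨C, hC, fun ε hε n hn hεn v => ?_⟩
  refine (open scoped Matrix.Norms.Operator in Matrix.linfty_opNorm_mulVec _ _).trans ?_
  exact mul_le_mul_of_nonneg_right (h R n ε (r n) hn hεn (H.entry_le n hn ε hε)) (norm_nonneg _)

/-- The limit of `weight β ε a x` as `ε → 0` and `x → ∞` with `ε x` bounded. -/
def limitWeight (β : ℝ) : ℝ := if β = 0 then 1 else 0

theorem tendsto_weight {β : ℝ} (hβ : 0 ≤ β) {ι : Type*} {l : Filter ι} {ε x : ι → ℝ} {Y a : ℝ}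
    (ha : 0 < a) (hx : Tendsto x l atTop) (hY : ∀ᶠ i in l, |ε i| * x i ≤ Y) :
    Tendsto (fun i => weight β (ε i) a (x i)) l (𝓝 (limitWeight β)) := by
  rcases eq_or_lt_of_le hβ with h0 | h0
  · subst h0
    simpa [weight, limitWeight] using tendsto_const_nhds
  · rw [limitWeight, if_neg h0.ne']
    have h1 : Tendsto (fun i => cosIntegral (ε i) a (x i)) l atTop := by
      have h2 : Tendsto (fun i => Real.log (x i / a) + -(Y ^ 2 / 4)) l atTop :=
        tendsto_atTop_add_const_right _ _ (Real.tendsto_log_atTop.comp (hx.atTop_div_const ha))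
      refine tendsto_atTop_mono' l ?_ h2
      filter_upwards [hY, hx.eventually_ge_atTop a] with i hi hxi
      have h3 := log_sub_le_cosIntegral (ε i) ha hxi
      have hx0 : 0 < x i := ha.trans_le hxi
      have h4 : ε i ^ 2 * (x i ^ 2 - a ^ 2) ≤ Y ^ 2 := by
        calc ε i ^ 2 * (x i ^ 2 - a ^ 2) ≤ (|ε i| * x i) ^ 2 := by
              rw [mul_pow, sq_abs]
              nlinarith [mul_nonneg (sq_nonneg (ε i)) (sq_nonneg a)]
          _ ≤ Y ^ 2 := by gcongr
      linarith
    refine Real.tendsto_exp_atBot.comp ?_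
    exact h1.const_mul_atTop_of_neg (by linarith)

/-- The common constant term of the two slow-scale equations; it is also `lim_n u_n(0, f)`. -/
def slowConst (β : ℝ) (R : ℕ → ℝ → Mat2) (f : Vec2) : Vec2 :=
  scaleSnd (limitWeight β) f + ∑' n : ℕ, if 1 ≤ n then
    scaleSnd (limitWeight β) ((stepRemainder β R n 0).mulVec (modelSol β R 0 f n)) else 0

theorem continuous_scaleSnd : Continuous fun p : ℝ × Vec2 => scaleSnd p.1 p.2 := by
  refine continuous_pi fun i => ?_
  fin_cases i
  · simp only [Fin.zero_eta, scaleSnd_zero]; fun_prop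
  · simp only [Fin.mk_one, scaleSnd_one]; fun_prop

/-- Dominated convergence for the inhomogeneous part of the variation-of-constants formula. -/
theorem ModelHyp.tendsto_sum_stepRemainder {β : ℝ} {U : Set ℝ} {R : ℕ → ℝ → Mat2} {r : ℕ → ℝ}
    (H : ModelHyp β U R r) (f : Vec2) {ι : Type*} {l : Filter ι} {ε x : ι → ℝ} {Y : ℝ}
    (hε : Tendsto ε l (𝓝 0)) (hx : Tendsto x l atTop) (hY : ∀ᶠ i in l, |ε i| * x i ≤ Y) :
    Tendsto (fun i => scaleSnd (weight β (ε i) 1 (x i)) f + ∑ n ∈ Finset.Ico 1 ⌊x i⌋₊,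
        scaleSnd (weight β (ε i) (n + 1) (x i))
          ((stepRemainder β R n (ε i)).mulVec (modelSol β R (ε i) f n))) l
      (𝓝 (slowConst β R f)) := by
  rcases l.eq_or_neBot with rfl | hl
  · exact tendsto_bot
  have hY0 : 0 ≤ Y := by
    obtain ⟨i, hi, hi'⟩ := (hY.and (hx.eventually_ge_atTop 0)).exists
    exact le_trans (mul_nonneg (abs_nonneg _) hi') hi
  have hscale : ∀ {w : ι → ℝ} {v : ι → Vec2} {w0 v0}, Tendsto w l (𝓝 w0) → Tendsto v l (𝓝 v0) →
      Tendsto (fun i => scaleSnd (w i) (v i)) l (𝓝 (scaleSnd w0 v0)) := fun hw hv =>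
    (continuous_scaleSnd.tendsto (_, _)).comp (hw.prodMk_nhds hv)
  refine (hscale (tendsto_weight H.nonneg one_pos hx hY) tendsto_const_nhds).add ?_
  obtain ⟨C, hC, hS⟩ := norm_stepRemainder_mulVec_le H hY0
  obtain ⟨D, hD, hu⟩ := norm_modelSol_le H.nonneg H.majorant_nonneg H.summable H.entry_le hY0
  set E := Real.exp (β * Y ^ 2)
  have hE : 1 ≤ E := Real.one_le_exp (by have := H.nonneg; positivity)
  have hsum : Summable fun n : ℕ => E * (C * (1 / (n : ℝ) ^ 2 + r n) * (D * ‖f‖)) :=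
    (((Real.summable_one_div_nat_pow.2 one_lt_two).add H.summable).mul_left C |>.mul_right
      _).mul_left _
  have key := tendsto_tsum_of_dominated_convergence (𝓕 := l)
    (f := fun i (n : ℕ) => if n ∈ Finset.Ico 1 ⌊x i⌋₊ then
        scaleSnd (weight β (ε i) (n + 1) (x i))
          ((stepRemainder β R n (ε i)).mulVec (modelSol β R (ε i) f n)) else 0)
    (g := fun n : ℕ => if 1 ≤ n then
      scaleSnd (limitWeight β) ((stepRemainder β R n 0).mulVec (modelSol β R 0 f n)) else 0)
    hsum ?_ ?_
  · refine key.congr fun i => ?_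
    rw [tsum_eq_sum (s := Finset.Ico 1 ⌊x i⌋₊) fun b hb => if_neg hb]
    exact Finset.sum_congr rfl fun n hn => if_pos hn
  · intro n
    by_cases hn : 1 ≤ n
    · rw [if_pos hn]
      have hev : ∀ᶠ i in l, n ∈ Finset.Ico 1 ⌊x i⌋₊ := by
        filter_upwards [hx.eventually_ge_atTop ((n + 1 : ℕ) : ℝ)] with i hi
        exact Finset.mem_Ico.2 ⟨hn, Nat.lt_of_succ_le (Nat.le_floor hi)⟩
      refine Tendsto.congr' (hev.mono fun i hi => (if_pos hi).symm) ?_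
      refine hscale (tendsto_weight H.nonneg (by positivity) hx hY) ?_
      exact Tendsto.comp (continuousAt_mulVec
        (continuousAt_stepRemainder_zero H.nonneg hn (H.continuousAt n hn))
        (H.continuousAt_modelSol f n)) hε
    · rw [if_neg hn]
      simp [hn]
  · filter_upwards [hY, hε.eventually H.mem_nhds, hx.eventually_gt_atTop 0] with i hi hU hx0 n
    have hpos : 0 ≤ E * (C * (1 / (n : ℝ) ^ 2 + r n) * (D * ‖f‖)) := by
      have := H.majorant_nonneg n
      positivity
    split_ifs with hn
    · obtain ⟨hn1, hn2⟩ := Finset.mem_Ico.1 hn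
      have hnx : ((n : ℝ) + 1) ≤ x i := by
        have := (Nat.le_floor_iff hx0.le).1 (Nat.succ_le_of_lt hn2)
        simpa using this
      have hnY : |ε i| * n ≤ Y :=
        le_trans (mul_le_mul_of_nonneg_left (by linarith) (abs_nonneg _)) hi
      have hw : |weight β (ε i) (n + 1) (x i)| ≤ E := by
        rw [abs_of_pos (weight_pos _ _ _ _)]
        exact weight_le H.nonneg (by positivity) hnx hi
      refine (norm_scaleSnd_le hE hw _).trans ?_
      have h1 := hS _ hU n hn1 hnY (modelSol β R (ε i) f n)
      have h2 := hu _ hU f n hnY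
      have := H.majorant_nonneg n
      refine mul_le_mul_of_nonneg_left (h1.trans ?_) (by linarith)
      gcongr
    · simpa using hpos

end

/-! ### Stability of Volterra equations -/

noncomputable section

open scoped ENNReal

/-- Grönwall inequality for the homogeneous Volterra inequality. -/
theorem eq_zero_of_le_lintegral {L : ℝ → ℝ≥0∞} {M C Y : ℝ} (hM : 0 ≤ M) (hC : 0 ≤ C)
    (hLC : ∀ y ∈ Set.Ioc 0 Y, L y ≤ ENNReal.ofReal C)
    (hL : ∀ y ∈ Set.Ioc 0 Y, L y ≤ ENNReal.ofReal M * ∫⁻ t in Set.Ioc 0 y, L t) :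
    ∀ y ∈ Set.Ioc 0 Y, L y = 0 := by
  have key : ∀ n : ℕ, ∀ y ∈ Set.Ioc 0 Y,
      L y ≤ ENNReal.ofReal (C * ((M * y) ^ n / n.factorial)) := by
    intro n
    induction n with
    | zero => simpa using hLC
    | succ n ih =>
      intro y hy
      have hint : IntegrableOn (fun t => C * ((M * t) ^ n / n.factorial)) (Set.Ioc 0 y) :=
        ((by fun_prop : Continuous fun t : ℝ => C * ((M * t) ^ n / n.factorial)
          ).integrableOn_Icc).mono_set Set.Ioc_subset_Icc_self
      calc L y ≤ ENNReal.ofReal M * ∫⁻ t in Set.Ioc 0 y, L t := hL y hy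
        _ ≤ ENNReal.ofReal M * ∫⁻ t in Set.Ioc 0 y,
              ENNReal.ofReal (C * ((M * t) ^ n / n.factorial)) := by
            gcongr 1
            refine setLIntegral_mono' measurableSet_Ioc fun t ht => ih t ⟨ht.1, ht.2.trans hy.2⟩
        _ = ENNReal.ofReal (M * ∫ t in (0 : ℝ)..y, C * ((M * t) ^ n / n.factorial)) := by
            rw [ENNReal.ofReal_mul hM, intervalIntegral.integral_of_le hy.1.le,
              ofReal_integral_eq_lintegral_ofReal hint]
            filter_upwards [ae_restrict_mem measurableSet_Ioc] with t ht
            have := ht.1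
            simp only [Pi.zero_apply]
            positivity
        _ = _ := by
            congr 1
            have e : ∀ t : ℝ, C * ((M * t) ^ n / n.factorial) =
              (C * M ^ n / n.factorial) * t ^ n := fun t => by rw [mul_pow]; ring
            simp only [e, intervalIntegral.integral_const_mul, integral_pow]
            rw [Nat.factorial_succ]
            push_cast
            have : (n.factorial : ℝ) ≠ 0 := by positivity
            field_simp
            simp only [mul_pow, pow_succ]
            ring
  intro y hy
  have ht : Tendsto (fun n : ℕ => ENNReal.ofReal (C * ((M * y) ^ n / n.factorial))) atTop
      (𝓝 0) := by
    have := (FloorSemiring.tendsto_pow_div_factorial_atTop (M * y)).const_mul C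
    rw [mul_zero] at this
    simpa [Function.comp_def] using (ENNReal.continuous_ofReal.tendsto _).comp this
  exact le_antisymm (ge_of_tendsto' ht fun n => key n y hy) bot_le

/-- Solutions of a Volterra inequality with an error term tending pointwise to zero tend to zero:
the pointwise upper limit solves the homogeneous inequality, by the reverse Fatou lemma. -/
theorem tendsto_zero_of_le_add_lintegral {g e : ℕ → ℝ → ℝ≥0∞} {M C Y : ℝ} (hM : 0 ≤ M)
    (hC : 0 ≤ C) (hg : ∀ k, Measurable (g k))
    (hgC : ∀ k, ∀ y ∈ Set.Ioc 0 Y, g k y ≤ ENNReal.ofReal C)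
    (he : ∀ y ∈ Set.Ioc 0 Y, Tendsto (fun k => e k y) atTop (𝓝 0))
    (h : ∀ k, ∀ y ∈ Set.Ioc 0 Y, g k y ≤ e k y + ENNReal.ofReal M * ∫⁻ t in Set.Ioc 0 y, g k t) :
    ∀ y ∈ Set.Ioc 0 Y, Tendsto (fun k => g k y) atTop (𝓝 0) := by
  have hL : ∀ y ∈ Set.Ioc 0 Y, limsup (fun k => g k y) atTop = 0 := by
    refine eq_zero_of_le_lintegral (L := fun y => limsup (fun k => g k y) atTop) hM hC ?_ ?_
    · intro y hy
      exact limsup_le_of_le (by isBoundedDefault) (Eventually.of_forall fun k => hgC k y hy)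
    · intro y hy
      have hy' : ∀ t ∈ Set.Ioc 0 y, t ∈ Set.Ioc 0 Y := fun t ht => ⟨ht.1, ht.2.trans hy.2⟩
      calc limsup (fun k => g k y) atTop
          ≤ limsup ((fun k => e k y) +
              fun k => ENNReal.ofReal M * ∫⁻ t in Set.Ioc 0 y, g k t) atTop :=
            limsup_le_limsup (Eventually.of_forall fun k => h k y hy) (by isBoundedDefault)
              (by isBoundedDefault)
        _ = ENNReal.ofReal M * limsup (fun k => ∫⁻ t in Set.Ioc 0 y, g k t) atTop := by
            rw [ENNReal.limsup_add_of_left_tendsto_zero (he y hy),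
              ENNReal.limsup_const_mul_of_ne_top ENNReal.ofReal_ne_top]
        _ ≤ _ := by
            gcongr 1
            refine limsup_lintegral_le (fun _ => ENNReal.ofReal C) hg (fun k => ?_) ?_
            · filter_upwards [ae_restrict_mem measurableSet_Ioc] with t ht
              exact hgC k t (hy' t ht)
            · simp [ENNReal.mul_ne_top]
  intro y hy
  refine tendsto_of_le_liminf_of_limsup_le bot_le (hL y hy).le

/-- Stability of Volterra equations: approximate solutions, with an error tending pointwise to a
constant, converge to a solution. -/
theorem exists_volterra_limit {α : Type*} {l : Filter α} [l.NeBot] [l.IsCountablyGenerated]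
    {φ : α → ℝ → Vec2} {p : ℝ → ℝ} {q : ℝ → ℝ → ℝ} {c : Vec2} {σ : ℝ}
    (hφ : ∀ ε, Measurable (φ ε)) (hp : ContinuousOn p (Set.Ioi 0))
    (hq : ∀ y, 0 < y → ContinuousOn (q y) (Set.Ioi 0))
    (hpq : ∀ Y, 0 < Y → ∃ M, 0 ≤ M ∧ ∀ y t, 0 < t → t ≤ y → y ≤ Y → |p t| ≤ M ∧ |q y t| ≤ M)
    (hφC : ∀ Y, 0 < Y → ∃ C, 0 ≤ C ∧ ∀ᶠ ε in l, ∀ t ∈ Set.Ioc 0 Y, ‖φ ε t‖ ≤ C)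
    (hlim : ∀ y, 0 < y → Tendsto
      (fun ε => φ ε y - σ • ∫ t in (0 : ℝ)..y, antidiagMul (p t) (q y t) (φ ε t)) l (𝓝 c)) :
    ∃ h : ℝ → Vec2, (∀ y, 0 < y → Tendsto (fun ε => φ ε y) l (𝓝 (h y))) ∧
      ∀ y, 0 < y → IntervalIntegrable (fun t => antidiagMul (p t) (q y t) (h t)) volume 0 y ∧
        h y = c + σ • ∫ t in (0 : ℝ)..y, antidiagMul (p t) (q y t) (h t) := by
  have hex : ∀ y, 0 < y → ∃ a, Tendsto (fun ε => φ ε y) l (𝓝 a) := by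
    intro Y hY
    obtain ⟨M, hM, hMb⟩ := hpq Y hY
    obtain ⟨C, hC, hCb⟩ := hφC Y hY
    rw [← cauchy_map_iff_exists_tendsto, cauchy_map_iff']
    -- by countable generation it suffices to compare the values along two sequences
    rw [uniformity_eq_comap_nhds_zero, tendsto_comap_iff]
    refine tendsto_of_seq_tendsto fun s hs => ?_
    obtain ⟨hs1, hs2⟩ : Tendsto (fun k => (s k).1) atTop l ∧ Tendsto (fun k => (s k).2) atTop l :=
      ⟨tendsto_fst.comp hs, tendsto_snd.comp hs⟩
    obtain ⟨K, hK⟩ := eventually_atTop.1 ((hs1.eventually hCb).and (hs2.eventually hCb))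
    rw [← tendsto_add_atTop_iff_nat K]
    set a : ℕ → α := fun k => (s (k + K)).1
    set b : ℕ → α := fun k => (s (k + K)).2
    have ha : Tendsto a atTop l := hs1.comp (tendsto_add_atTop_nat K)
    have hb : Tendsto b atTop l := hs2.comp (tendsto_add_atTop_nat K)
    have haC : ∀ k, ∀ t ∈ Set.Ioc 0 Y, ‖φ (a k) t‖ ≤ C := fun k => (hK (k + K) (by omega)).1
    have hbC : ∀ k, ∀ t ∈ Set.Ioc 0 Y, ‖φ (b k) t‖ ≤ C := fun k => (hK (k + K) (by omega)).2
    set δ : α → ℝ → Vec2 := fun ε y =>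
      φ ε y - σ • ∫ t in (0 : ℝ)..y, antidiagMul (p t) (q y t) (φ ε t) with hδ
    have hInt : ∀ ε, (∀ t ∈ Set.Ioc 0 Y, ‖φ ε t‖ ≤ C) → ∀ y ∈ Set.Ioc 0 Y,
        IntervalIntegrable (fun t => antidiagMul (p t) (q y t) (φ ε t)) volume 0 y := by
      intro ε hε y hy
      exact intervalIntegrable_antidiagMul hy.1.le hp (hq y hy.1) (hφ ε)
        (fun t ht => (hMb y t ht.1 ht.2 hy.2).1) (fun t ht => (hMb y t ht.1 ht.2 hy.2).2)
        (fun t ht => hε t ⟨ht.1, ht.2.trans hy.2⟩)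
    have hz := tendsto_zero_of_le_add_lintegral (Y := Y) (M := |σ| * M) (C := 2 * C)
      (g := fun k t => ‖φ (b k) t - φ (a k) t‖ₑ) (e := fun k t => ‖δ (b k) t - δ (a k) t‖ₑ)
      (by positivity) (by positivity) (fun k => ((hφ _).sub (hφ _)).enorm) ?_ ?_ ?_ Y ⟨hY, le_rfl⟩
    · rw [tendsto_zero_iff_enorm_tendsto_zero]
      exact hz
    · intro k y hy
      rw [← ofReal_norm]
      refine ENNReal.ofReal_le_ofReal ((norm_sub_le _ _).trans ?_)
      linarith [haC k y hy, hbC k y hy]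
    · intro y hy
      have h0 : Tendsto (fun k => δ (b k) y - δ (a k) y) atTop (𝓝 0) := by
        simpa using ((hlim y hy.1).comp hb).sub ((hlim y hy.1).comp ha)
      simpa using h0.enorm
    · intro k y hy
      have e1 : φ (b k) y - φ (a k) y = (δ (b k) y - δ (a k) y) +
          σ • ∫ t in (0 : ℝ)..y, antidiagMul (p t) (q y t) (φ (b k) t - φ (a k) t) := by
        simp only [← antidiagMul_sub]
        rw [intervalIntegral.integral_sub (hInt _ (hbC k) y hy) (hInt _ (haC k) y hy), smul_sub]
        simp only [hδ]
        abel
      rw [e1]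
      refine (enorm_add_le _ _).trans ?_
      gcongr
      rw [enorm_smul, ENNReal.ofReal_mul (abs_nonneg _), mul_assoc, ← Real.norm_eq_abs,
        ofReal_norm]
      gcongr
      rw [intervalIntegral.integral_of_le hy.1.le]
      refine (enorm_integral_le_lintegral_enorm _).trans ?_
      rw [← lintegral_const_mul' _ _ ENNReal.ofReal_ne_top]
      refine setLIntegral_mono' measurableSet_Ioc fun t ht => ?_
      rw [← ofReal_norm, ← ofReal_norm, ← ENNReal.ofReal_mul hM]
      obtain ⟨h1, h2⟩ := hMb y t ht.1 ht.2 hy.2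
      exact ENNReal.ofReal_le_ofReal (norm_antidiagMul_le h1 h2 _)
  choose! h hh using hex
  refine ⟨h, hh, fun y hy => ?_⟩
  obtain ⟨M, hM, hMb⟩ := hpq y hy
  obtain ⟨C, hC, hCb⟩ := hφC y hy
  have hcont : ∀ t, Continuous (antidiagMul (p t) (q y t)) := fun t => by
    refine continuous_pi fun i => ?_
    fin_cases i
    · simp only [Fin.zero_eta, antidiagMul_zero]; fun_prop
    · simp only [Fin.mk_one, antidiagMul_one]; fun_prop
  have hpt : ∀ᵐ t ∂volume.restrict (Set.Ioc 0 y),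
      Tendsto (fun ε => antidiagMul (p t) (q y t) (φ ε t)) l
        (𝓝 (antidiagMul (p t) (q y t) (h t))) := by
    filter_upwards [ae_restrict_mem measurableSet_Ioc] with t ht
    exact ((hcont t).tendsto _).comp (hh t ht.1)
  have hmeas : ∀ ε, AEStronglyMeasurable (fun t => antidiagMul (p t) (q y t) (φ ε t))
      (volume.restrict (Set.Ioc 0 y)) := fun ε =>
    aestronglyMeasurable_antidiagMul hp (hq y hy) (hφ ε)
  have hInt : IntervalIntegrable (fun t => antidiagMul (p t) (q y t) (h t)) volume 0 y := by
    rw [intervalIntegrable_iff_integrableOn_Ioc_of_le hy.le]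
    refine Integrable.of_bound (aestronglyMeasurable_of_tendsto_ae l hmeas hpt) (M * C) ?_
    filter_upwards [ae_restrict_mem measurableSet_Ioc] with t ht
    obtain ⟨h1, h2⟩ := hMb y t ht.1 ht.2 le_rfl
    refine (norm_antidiagMul_le h1 h2 _).trans (mul_le_mul_of_nonneg_left ?_ hM)
    exact le_of_tendsto (hh t ht.1).norm (hCb.mono fun ε hε => hε t ht)
  refine ⟨hInt, ?_⟩
  have hI : Tendsto (fun ε => ∫ t in (0 : ℝ)..y, antidiagMul (p t) (q y t) (φ ε t)) l
      (𝓝 (∫ t in (0 : ℝ)..y, antidiagMul (p t) (q y t) (h t))) := by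
    refine intervalIntegral.tendsto_integral_filter_of_dominated_convergence
      (fun _ => M * C) (Eventually.of_forall fun ε => ?_) ?_ (by simp) ?_
    · rw [Set.uIoc_of_le hy.le]; exact hmeas ε
    · filter_upwards [hCb] with ε hε
      refine Eventually.of_forall fun t ht => ?_
      rw [Set.uIoc_of_le hy.le] at ht
      obtain ⟨h1, h2⟩ := hMb y t ht.1 ht.2 le_rfl
      exact (norm_antidiagMul_le h1 h2 _).trans (mul_le_mul_of_nonneg_left (hε t ht) hM)
    · refine Eventually.of_forall fun t ht => ?_
      rw [Set.uIoc_of_le hy.le] at ht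
      exact ((hcont t).tendsto _).comp (hh t ht.1)
  have h1 := (hlim y hy).add (hI.const_smul σ)
  simp only [sub_add_cancel] at h1
  exact tendsto_nhds_unique (hh y hy) h1

end

/-! ### The slow-scale limit -/

noncomputable section

/-- The kernel in the form of the unscaled one at `ε = 1`. -/
theorem slowKernel_mulVec (β y t : ℝ) (v : Vec2) : (slowKernel β y t).mulVec v =
    antidiagMul (β * (Real.sin (1 * t) / t)) (weight β 1 t y * (β * (Real.sin (1 * t) / t))) v := by
  have : ∫ s in t..y, Real.cos s / s = cosIntegral 1 t y := by simp [cosIntegral]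
  ext i
  fin_cases i
  · simp [slowKernel, Matrix.mulVec, dotProduct, Fin.sum_univ_two]
    exact Or.inl (by ring)
  · simp [slowKernel, Matrix.mulVec, dotProduct, Fin.sum_univ_two, weight, this]
    exact Or.inl (by ring)

theorem cosIntegral_eq_cosIntegral_one {ε : ℝ} (hε : ε ≠ 0) (a b : ℝ) :
    cosIntegral ε a b = cosIntegral 1 (|ε| * a) (|ε| * b) := by
  have h := intervalIntegral.integral_comp_mul_left (a := a) (b := b)
    (fun s => Real.cos (1 * s) / s) (abs_ne_zero.2 hε)
  have h2 : cosIntegral ε a b = |ε| * ∫ x in a..b, Real.cos (1 * (|ε| * x)) / (|ε| * x) := by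
    rw [← intervalIntegral.integral_const_mul]
    unfold cosIntegral
    congr 1
    ext s
    have : Real.cos (ε * s) = Real.cos (1 * (|ε| * s)) := by
      rcases abs_choice ε with h | h <;> rw [h] <;> simp
    rw [this]
    rcases eq_or_ne s 0 with rfl | hs
    · simp
    · have := abs_ne_zero.2 hε
      field_simp
  rw [h2, h, smul_eq_mul, ← mul_assoc, mul_inv_cancel₀ (abs_ne_zero.2 hε), one_mul]
  rfl

/-- Passage to the slow variable `t = |ε| r`. -/
theorem integral_drift_eq {β σ ε y : ℝ} (hε : ε ≠ 0) (hσ : ε = σ * |ε|) (u : ℕ → Vec2) :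
    ∫ r in (0 : ℝ)..(y / |ε|), drift β ε (y / |ε|) u r =
      σ • ∫ t in (0 : ℝ)..y, antidiagMul (β * (Real.sin (1 * t) / t))
        (weight β 1 t y * (β * (Real.sin (1 * t) / t))) (u ⌊t / |ε|⌋₊) := by
  have h0 := abs_ne_zero.2 hε
  have hσ' : σ = 1 ∨ σ = -1 := by
    have h : |σ| * |ε| = 1 * |ε| := by
      have := congrArg abs hσ
      rw [abs_mul, abs_abs] at this
      rw [← this, one_mul]
    exact eq_or_eq_neg_of_abs_eq (mul_right_cancel₀ h0 h)
  set F : ℝ → Vec2 := fun t => antidiagMul (β * (Real.sin (1 * t) / t))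
        (weight β 1 t y * (β * (Real.sin (1 * t) / t))) (u ⌊t / |ε|⌋₊) with hF
  have h := intervalIntegral.integral_comp_mul_left (a := 0) (b := y / |ε|) F h0
  have hd : drift β ε (y / |ε|) u = fun r => (σ * |ε|) • F (|ε| * r) := by
    ext1 r
    have e1 : |ε| * r / |ε| = r := by field_simp
    have e2 : weight β 1 (|ε| * r) y = weight β ε r (y / |ε|) := by
      unfold weight
      rw [cosIntegral_eq_cosIntegral_one hε r, mul_div_cancel₀ _ h0]
    have e3 : Real.sin (ε * r) / r = σ * |ε| * (Real.sin (1 * (|ε| * r)) / (|ε| * r)) := by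
      have : Real.sin (ε * r) = σ * Real.sin (1 * (|ε| * r)) := by
        nth_rewrite 1 [hσ]
        rcases hσ' with h | h <;> rw [h] <;> simp
      rw [this]
      rcases eq_or_ne r 0 with rfl | hr
      · simp
      · field_simp
    simp only [drift, hF, e1, e2, e3]
    ext i
    fin_cases i <;> simp <;> ring
  rw [hd, intervalIntegral.integral_smul, h, mul_zero, mul_div_cancel₀ _ h0, smul_smul]
  congr 1
  field_simp

theorem norm_sub_scaleSnd_le (w : ℝ) (v : Vec2) : ‖v - scaleSnd w v‖ ≤ |1 - w| * ‖v‖ := by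
  rw [pi_norm_le_iff_of_nonneg (by positivity)]
  intro i
  fin_cases i
  · simp only [Fin.zero_eta, Pi.sub_apply, scaleSnd_zero, sub_self, norm_zero]
    positivity
  · have : v 1 - (w : ℂ) * v 1 = ((1 - w : ℝ) : ℂ) * v 1 := by push_cast; ring
    simp only [Fin.mk_one, Pi.sub_apply, scaleSnd_one, this, norm_mul, Complex.norm_real]
    exact mul_le_mul_of_nonneg_left (norm_le_pi_norm v 1) (norm_nonneg _)

variable {β : ℝ} {U : Set ℝ} {R : ℕ → ℝ → Mat2} {r : ℕ → ℝ}

theorem scaleSnd_zero_left_apply_one (v : Vec2) : scaleSnd 0 v 1 = 0 := by simp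

/-- The homogeneous weight kills the second component: it tends to `0` when `β > 0`. -/
theorem slowConst_apply_one (hβ : 0 < β) (f : Vec2) : slowConst β R f 1 = 0 := by
  have hw : limitWeight β = 0 := if_neg hβ.ne'
  unfold slowConst
  rw [hw, Pi.add_apply, scaleSnd_zero_left_apply_one, zero_add]
  by_cases hs : Summable fun n : ℕ => if 1 ≤ n then
      scaleSnd 0 ((stepRemainder β R n 0).mulVec (modelSol β R 0 f n)) else 0
  · rw [tsum_apply hs]
    refine (tsum_congr fun n => ?_).trans tsum_zero
    split_ifs <;> simp
  · rw [tsum_eq_zero_of_not_summable hs, Pi.zero_apply]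

theorem drift_zero (β x : ℝ) (u : ℕ → Vec2) : drift β 0 x u = 0 := by
  ext r i
  fin_cases i <;> simp [drift]

theorem ModelHyp.tendsto_modelSol_zero (H : ModelHyp β U R r) (f : Vec2) :
    Tendsto (modelSol β R 0 f) atTop (𝓝 (slowConst β R f)) := by
  have h := H.tendsto_sum_stepRemainder f (l := atTop) (ε := fun _ : ℕ => 0)
    (x := fun n : ℕ => (n : ℝ)) (Y := 0) tendsto_const_nhds tendsto_natCast_atTop_atTop (by simp)
  refine h.congr' ?_
  filter_upwards [eventually_ge_atTop 1] with N hN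
  have e := scaleSnd_modelSol_eq H.nonneg R 0 f hN (x := N) le_rfl
  have hw : weight β 0 N N = 1 := by simp [weight, cosIntegral]
  rw [hw, drift_zero] at e
  have h1 : scaleSnd 1 (modelSol β R 0 f N) = modelSol β R 0 f N := by
    ext i; fin_cases i <;> simp
  rw [h1] at e
  rw [e]
  simp

/-- Approximate integral equation on the slow scale. -/
theorem ModelHyp.tendsto_sub_integral (H : ModelHyp β U R r) (f : Vec2) {l : Filter ℝ}
    (hl : l ≤ 𝓝[≠] 0) {σ : ℝ} (hσ : ∀ᶠ ε in l, ε = σ * |ε|) {y : ℝ} (hy : 0 < y) :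
    Tendsto (fun ε => modelSol β R ε f ⌊y / |ε|⌋₊ - σ • ∫ t in (0 : ℝ)..y,
      antidiagMul (β * (Real.sin (1 * t) / t)) (weight β 1 t y * (β * (Real.sin (1 * t) / t)))
        (modelSol β R ε f ⌊t / |ε|⌋₊)) l (𝓝 (slowConst β R f)) := by
  have hβ := H.nonneg
  have hε0 : Tendsto (fun ε : ℝ => ε) l (𝓝 0) := (tendsto_id.mono_left hl).mono_right inf_le_left
  have hne : ∀ᶠ ε in l, ε ≠ 0 := hl self_mem_nhdsWithin
  have habs : Tendsto (fun ε : ℝ => |ε|) l (𝓝 0) := by simpa using hε0.abs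
  have hx : Tendsto (fun ε : ℝ => y / |ε|) l atTop := by
    have h1 : Tendsto (fun ε : ℝ => |ε|) l (𝓝[>] 0) :=
      tendsto_nhdsWithin_iff.2 ⟨habs, hne.mono fun ε h => abs_pos.2 h⟩
    simpa [div_eq_mul_inv] using h1.inv_tendsto_nhdsGT_zero.const_mul_atTop hy
  have hY : ∀ᶠ ε : ℝ in l, |ε| * (y / |ε|) ≤ y :=
    hne.mono fun ε h => (mul_div_cancel₀ _ (abs_ne_zero.2 h)).le
  obtain ⟨D, hD, hu⟩ := norm_modelSol_le hβ H.majorant_nonneg H.summable H.entry_le hy.le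
  have hN : Tendsto (fun ε : ℝ => ⌊y / |ε|⌋₊) l atTop := tendsto_nat_floor_atTop.comp hx
  have hNinv : Tendsto (fun ε : ℝ => 1 / (⌊y / |ε|⌋₊ : ℝ)) l (𝓝 0) :=
    tendsto_one_div_atTop_nhds_zero_nat.comp hN
  have hbound : ∀ᶠ ε in l, ‖modelSol β R ε f ⌊y / |ε|⌋₊‖ ≤ D * ‖f‖ := by
    filter_upwards [hε0.eventually H.mem_nhds, hY] with ε hεU hεY
    refine hu ε hεU f _ (le_trans ?_ hεY)
    exact mul_le_mul_of_nonneg_left (Nat.floor_le (by positivity)) (abs_nonneg _)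
  have hmain := H.tendsto_sum_stepRemainder f hε0 hx hY
  -- the weight over the last, incomplete step tends to one
  have hw : Tendsto (fun ε => weight β ε ⌊y / |ε|⌋₊ (y / |ε|)) l (𝓝 1) := by
    have hc : Tendsto (fun ε => cosIntegral ε ⌊y / |ε|⌋₊ (y / |ε|)) l (𝓝 0) := by
      refine squeeze_zero_norm' ?_ hNinv
      filter_upwards [hN.eventually_ge_atTop 1] with ε h1
      have hp : (0 : ℝ) < ⌊y / |ε|⌋₊ := by exact_mod_cast h1
      refine (abs_cosIntegral_le ε hp (Nat.floor_le (by positivity))).trans ?_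
      gcongr
      linarith [Nat.lt_floor_add_one (y / |ε|)]
    have := (Real.continuous_exp.tendsto _).comp (hc.const_mul (-2 * β))
    simpa [weight, Function.comp_def] using this
  have hA : Tendsto (fun ε => modelSol β R ε f ⌊y / |ε|⌋₊ -
      scaleSnd (weight β ε ⌊y / |ε|⌋₊ (y / |ε|)) (modelSol β R ε f ⌊y / |ε|⌋₊)) l (𝓝 0) := by
    have h0 : Tendsto (fun ε => |1 - weight β ε ⌊y / |ε|⌋₊ (y / |ε|)| * (D * ‖f‖)) l (𝓝 0) := by
      simpa using ((tendsto_const_nhds (x := (1 : ℝ))).sub hw).abs.mul_const (D * ‖f‖)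
    refine squeeze_zero_norm' ?_ h0
    filter_upwards [hbound] with ε hb
    exact (norm_sub_scaleSnd_le _ _).trans (mul_le_mul_of_nonneg_left hb (abs_nonneg _))
  have hB : Tendsto (fun ε => ∫ r in (⌊y / |ε|⌋₊ : ℝ)..(y / |ε|),
      drift β ε (y / |ε|) (modelSol β R ε f) r) l (𝓝 0) := by
    have h0 : Tendsto (fun ε : ℝ => Real.exp (β * y ^ 2) * (β * |ε|) * (D * ‖f‖)) l (𝓝 0) := by
      simpa using ((habs.const_mul β).const_mul (Real.exp (β * y ^ 2))).mul_const (D * ‖f‖)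
    refine squeeze_zero_norm' ?_ h0
    filter_upwards [hbound, hY, hN.eventually_ge_atTop 1] with ε hb hεY h1
    have hp : (0 : ℝ) < ⌊y / |ε|⌋₊ := by exact_mod_cast h1
    have hle : (⌊y / |ε|⌋₊ : ℝ) ≤ y / |ε| := Nat.floor_le (by positivity)
    have hlt := Nat.lt_floor_add_one (y / |ε|)
    have h := intervalIntegral.norm_integral_le_of_norm_le_const (a := (⌊y / |ε|⌋₊ : ℝ))
      (b := y / |ε|) (C := Real.exp (β * y ^ 2) * (β * |ε|) * (D * ‖f‖))
      (f := drift β ε (y / |ε|) (modelSol β R ε f)) (by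
        intro r hr
        rw [Set.uIoc_of_le hle] at hr
        refine (norm_drift_le hβ hεY (hp.trans hr.1) hr.2 _).trans ?_
        have : ⌊r⌋₊ = ⌊y / |ε|⌋₊ :=
          le_antisymm (Nat.floor_mono hr.2) (Nat.le_floor hr.1.le)
        rw [this]
        gcongr)
    refine h.trans (mul_le_of_le_one_right (by positivity) ?_)
    rw [abs_of_nonneg (by linarith)]
    linarith
  have hall := (hmain.add hA).sub hB
  simp only [add_zero, sub_zero] at hall
  refine hall.congr' ?_
  filter_upwards [hne, hσ, hN.eventually_ge_atTop 1] with ε h0 hs h1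
  have hle : (⌊y / |ε|⌋₊ : ℝ) ≤ y / |ε| := Nat.floor_le (by positivity)
  have hx0 : 0 ≤ y / |ε| := by positivity
  have e := scaleSnd_modelSol_eq hβ R ε f h1 hle
  rw [← integral_drift_eq h0 hs, ← intervalIntegral.integral_add_adjacent_intervals
    (intervalIntegrable_drift hβ ε (x := y / |ε|) (b := (⌊y / |ε|⌋₊ : ℝ)) ⟨le_rfl, hx0⟩
      ⟨by positivity, hle⟩ _)
    (intervalIntegrable_drift hβ ε ⟨by positivity, hle⟩ ⟨hx0, le_rfl⟩ _), e]
  abel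

/-- Existence of the slow-scale limit and its integral equation. -/
theorem ModelHyp.exists_slow_limit (H : ModelHyp β U R r) (f : Vec2) {l : Filter ℝ} [l.NeBot]
    [l.IsCountablyGenerated] (hl : l ≤ 𝓝[≠] 0) {σ : ℝ} (hσ : ∀ᶠ ε in l, ε = σ * |ε|) :
    ∃ h : ℝ → Vec2, (∀ y, 0 < y →
      Tendsto (fun ε : ℝ => modelSol β R ε f ⌊y / |ε|⌋₊) l (𝓝 (h y))) ∧
      SolvesSlowEquation β σ (slowConst β R f) h := by
  have hβ := H.nonneg
  simp only [SolvesSlowEquation, slowKernel_mulVec]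
  refine exists_volterra_limit (φ := fun ε t => modelSol β R ε f ⌊t / |ε|⌋₊)
    (p := fun t => β * (Real.sin (1 * t) / t))
    (q := fun y t => weight β 1 t y * (β * (Real.sin (1 * t) / t))) ?_
    (continuousOn_sin_mul_div β 1) (fun y hy => continuousOn_weight_mul_sin β 1 hy) ?_ ?_
    (fun y hy => H.tendsto_sub_integral f hl hσ hy)
  · intro ε
    exact (measurable_from_nat (f := modelSol β R ε f)).comp
      (Nat.measurable_floor.comp (measurable_id.div_const _))
  · intro Y hY
    refine ⟨Real.exp (β * Y ^ 2) * (β * |1|), by positivity, fun y t ht hty hyY => ?_⟩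
    have h1 := abs_mul_sin_div_le hβ 1 t
    refine ⟨h1.trans (le_mul_of_one_le_left (by positivity) (Real.one_le_exp (by positivity))), ?_⟩
    rw [abs_mul, abs_of_pos (weight_pos _ _ _ _)]
    exact mul_le_mul (weight_le hβ ht hty (by simpa using hyY)) h1 (abs_nonneg _)
      (Real.exp_pos _).le
  · intro Y hY
    obtain ⟨D, hD, hu⟩ := norm_modelSol_le hβ H.majorant_nonneg H.summable H.entry_le hY.le
    refine ⟨D * ‖f‖, by positivity, ?_⟩
    filter_upwards [hl (mem_nhdsWithin_of_mem_nhds H.mem_nhds), hl self_mem_nhdsWithin] with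
      ε hεU hε0 t ht
    have h0 : 0 < |ε| := abs_pos.2 hε0
    refine hu ε hεU f _ ?_
    calc |ε| * (⌊t / |ε|⌋₊ : ℝ) ≤ |ε| * (t / |ε|) := by
          gcongr
          exact Nat.floor_le (div_nonneg ht.1.le h0.le)
      _ = t := mul_div_cancel₀ _ h0.ne'
      _ ≤ Y := ht.2

end

/-! ### Summation by parts away from `ε = 0` -/

noncomputable section

/-- If a sequence becomes almost constant after a near-identity change of variables, it is
almost constant. -/
theorem norm_sub_le_of_near_identity {E : Type*} [NormedAddCommGroup E] {u v : ℕ → E} {N : ℕ}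
    {γ τ : ℝ} {η : ℕ → ℝ} (hγ : γ ≤ 1 / 2) (huv : ∀ n, N ≤ n → ‖u n - v n‖ ≤ γ * ‖u n‖)
    (hη : ∀ n, N ≤ n → 0 ≤ η n) (hv : ∀ n, N ≤ n → ‖v (n + 1) - v n‖ ≤ η n * ‖u n‖)
    (hτ : ∀ n, ∑ m ∈ Finset.Ico N n, η m ≤ τ) (hτ1 : τ ≤ 1) :
    ∀ n, N ≤ n → ‖u n - u N‖ ≤ 25 * (γ + τ) * ‖u N‖ := by
  have huv2 : ∀ n, N ≤ n → ‖u n‖ ≤ 2 * ‖v n‖ := fun n hn => by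
    have h1 := huv n hn
    have h2 : ‖u n‖ ≤ ‖u n - v n‖ + ‖v n‖ := by simpa using norm_add_le (u n - v n) (v n)
    nlinarith [norm_nonneg (u n)]
  have hvN : ‖v N‖ ≤ 3 / 2 * ‖u N‖ := by
    have h1 := huv N le_rfl
    have h2 : ‖v N‖ ≤ ‖u N‖ + ‖u N - v N‖ := by simpa using norm_sub_le (u N) (u N - v N)
    nlinarith [norm_nonneg (u N)]
  have hgrow : ∀ n, N ≤ n → ‖v n‖ ≤ 8 * ‖v N‖ := fun n hn => by
    have h := le_exp_sum_mul (a := fun m => ‖v m‖) (η := fun m => 2 * η m) hn (by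
      intro m hm _
      have h1 : ‖v (m + 1)‖ ≤ ‖v (m + 1) - v m‖ + ‖v m‖ := by
        simpa using norm_add_le (v (m + 1) - v m) (v m)
      have h2 := Real.add_one_le_exp (2 * η m)
      have h3 := mul_le_mul_of_nonneg_left (huv2 m hm) (hη m hm)
      have h4 := hv m hm
      nlinarith [norm_nonneg (v m)])
    refine h.trans (mul_le_mul_of_nonneg_right ?_ (norm_nonneg _))
    rw [← Finset.mul_sum]
    have h1 : Real.exp (2 * ∑ m ∈ Finset.Ico N n, η m) ≤ Real.exp (1 + 1) :=
      Real.exp_le_exp.2 (by linarith [hτ n])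
    rw [Real.exp_add] at h1
    have h2 := Real.exp_one_lt_d9
    have h3 := Real.exp_pos 1
    nlinarith
  have hu : ∀ n, N ≤ n → ‖u n‖ ≤ 24 * ‖u N‖ := fun n hn => by
    linarith [huv2 n hn, hgrow n hn]
  have hdiff : ∀ n, N ≤ n → ‖v n - v N‖ ≤ (∑ m ∈ Finset.Ico N n, η m) * (24 * ‖u N‖) := by
    intro n hn
    induction n, hn using Nat.le_induction with
    | base => simp
    | succ n hn ih =>
      rw [Finset.sum_Ico_succ_top hn, add_mul]
      have h1 : ‖v (n + 1) - v N‖ ≤ ‖v n - v N‖ + ‖v (n + 1) - v n‖ := by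
        have := norm_add_le (v n - v N) (v (n + 1) - v n)
        rwa [show v n - v N + (v (n + 1) - v n) = v (n + 1) - v N by abel] at this
      have h2 := (hv n hn).trans (mul_le_mul_of_nonneg_left (hu n hn) (hη n hn))
      linarith
  intro n hn
  have e : u n - u N = (u n - v n) + (v n - v N) - (u N - v N) := by abel
  have h1 : ‖u n - u N‖ ≤ ‖u n - v n‖ + ‖v n - v N‖ + ‖u N - v N‖ := by
    rw [e]
    exact (norm_sub_le _ _).trans (by linarith [norm_add_le (u n - v n) (v n - v N)])
  have hu0 := norm_nonneg (u N)
  have h2 : ‖v n - v N‖ ≤ τ * (24 * ‖u N‖) :=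
    (hdiff n hn).trans (mul_le_mul_of_nonneg_right (hτ n) (by positivity))
  rcases hu0.eq_or_lt with h0 | h0
  · have h3 := hu n hn
    have h4 : u n = 0 := norm_le_zero_iff.1 (by rw [← h0] at h3; simpa using h3)
    have h5 : u N = 0 := norm_eq_zero.1 h0.symm
    simp [h4, h5]
  · have hγ0 : 0 ≤ γ := by
      by_contra hneg
      have := (norm_nonneg _).trans (huv N le_rfl)
      nlinarith
    have hτ0 : 0 ≤ τ := by simpa using hτ N
    have h3 := huv N le_rfl
    have h4 := (huv n hn).trans (mul_le_mul_of_nonneg_left (hu n hn) hγ0)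
    nlinarith

/-- Up to `O (1 / n²)` the integral over a unit interval is an exact difference, by partial
integration. -/
theorem abs_cosIntegral_sub_diff_le {ε : ℝ} (hε : ε ≠ 0) {a : ℝ} (ha : 0 < a) :
    |cosIntegral ε a (a + 1) - (Real.sin (ε * (a + 1)) / (ε * (a + 1)) -
      Real.sin (ε * a) / (ε * a))| ≤ 1 / |ε| / a ^ 2 := by
  have hd : ∀ s ∈ Set.uIcc a (a + 1), HasDerivAt (fun s => Real.sin (ε * s) / (ε * s))
      (Real.cos (ε * s) / s - Real.sin (ε * s) / (ε * s ^ 2)) s := by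
    intro s hs
    have hs0 : 0 < s := pos_of_mem_uIcc ha (by linarith) hs
    have h1 : HasDerivAt (fun s => ε * s) ε s := by
      simpa using (hasDerivAt_id s).const_mul ε
    have h := h1.sin.div h1 (mul_ne_zero hε hs0.ne')
    refine h.congr_deriv ?_
    field_simp
  have hi : IntervalIntegrable (fun s => Real.sin (ε * s) / (ε * s ^ 2)) volume a (a + 1) := by
    apply ContinuousOn.intervalIntegrable
    intro s hs
    have hs0 : 0 < s := pos_of_mem_uIcc ha (by linarith) hs
    have : ε * s ^ 2 ≠ 0 := by positivity
    exact ContinuousAt.continuousWithinAt (by fun_prop (disch := assumption))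
  have hc := intervalIntegrable_cos_div ε ha (by linarith : 0 < a + 1)
  have h := intervalIntegral.integral_eq_sub_of_hasDerivAt hd (hc.sub hi)
  rw [← h, intervalIntegral.integral_sub hc hi]
  unfold cosIntegral
  rw [sub_sub_cancel]
  have hb := intervalIntegral.norm_integral_le_of_norm_le_const (a := a) (b := a + 1)
    (C := 1 / |ε| / a ^ 2) (f := fun s => Real.sin (ε * s) / (ε * s ^ 2)) (by
      intro s hs
      rw [Set.uIoc_of_le (by linarith)] at hs
      have hs0 : 0 < s := ha.trans hs.1
      rw [Real.norm_eq_abs, abs_div, abs_mul, abs_of_pos (pow_pos hs0 2), div_div]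
      have h0 : 0 < |ε| := abs_pos.2 hε
      refine div_le_div₀ zero_le_one (Real.abs_sin_le_one _) (by positivity) ?_
      have := hs.1.le
      gcongr)
  simpa using hb

/-- The Abel summation primitive of `exp (i ε n) / n`. -/
def abelPrimitive (ε : ℝ) (n : ℕ) : ℂ :=
  Complex.exp (ε * Complex.I) ^ n / ((Complex.exp (ε * Complex.I) - 1) * n)

theorem norm_abelPrimitive_le (ε : ℝ) (n : ℕ) :
    ‖abelPrimitive ε n‖ ≤ 1 / ‖Complex.exp (ε * Complex.I) - 1‖ / n := by
  unfold abelPrimitive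
  rw [norm_div, norm_pow, Complex.norm_exp_ofReal_mul_I, one_pow, norm_mul, div_div]
  simp

/-- Abel summation: up to `O (1 / n²)` the term `exp (i ε n) / n` is an exact difference. -/
theorem norm_sub_abelPrimitive_diff_le {ε : ℝ} (hε : Complex.exp (ε * Complex.I) ≠ 1) {n : ℕ}
    (hn : 1 ≤ n) : ‖Complex.exp (ε * Complex.I) ^ n / n -
      (abelPrimitive ε (n + 1) - abelPrimitive ε n)‖ ≤
      1 / ‖Complex.exp (ε * Complex.I) - 1‖ / n ^ 2 := by
  have hz : Complex.exp (ε * Complex.I) - 1 ≠ 0 := sub_ne_zero.2 hε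
  have hn0 : (n : ℂ) ≠ 0 := by exact_mod_cast (by omega : n ≠ 0)
  have hn1 : (n : ℂ) + 1 ≠ 0 := by exact_mod_cast (by omega : n + 1 ≠ 0)
  have e : Complex.exp (ε * Complex.I) ^ n / n - (abelPrimitive ε (n + 1) - abelPrimitive ε n) =
      Complex.exp (ε * Complex.I) ^ (n + 1) /
        ((Complex.exp (ε * Complex.I) - 1) * (n * (n + 1))) := by
    unfold abelPrimitive
    push_cast
    field_simp
    ring
  rw [e, norm_div, norm_pow, Complex.norm_exp_ofReal_mul_I, one_pow, norm_mul, div_div]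
  have hp : (0 : ℝ) < n := by exact_mod_cast hn
  have hz' := norm_pos_iff.2 hz
  apply one_div_le_one_div_of_le (by positivity)
  gcongr
  rw [norm_mul]
  have h1 : ‖(n : ℂ) + 1‖ = n + 1 := by
    have : (n : ℂ) + 1 = ((n + 1 : ℕ) : ℂ) := by push_cast; ring
    rw [this, Complex.norm_natCast]; push_cast; ring
  rw [h1, Complex.norm_natCast]
  nlinarith

theorem exp_mul_I_pow (ε : ℝ) (n : ℕ) : Complex.exp (ε * Complex.I) ^ n =
    Real.cos (ε * n) + Real.sin (ε * n) * Complex.I := by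
  rw [← Complex.exp_nat_mul, Complex.ofReal_cos, Complex.ofReal_sin, ← Complex.exp_mul_I]
  congr 1
  push_cast
  ring

/-- The real symmetric matrix `[[s + p, q], [q, s - p]]`. -/
def symMatrix (s p q : ℝ) : Mat2 :=
  !![((s + p : ℝ) : ℂ), (q : ℂ); (q : ℂ), ((s - p : ℝ) : ℂ)]

theorem symMatrix_add (s p q s' p' q' : ℝ) :
    symMatrix s p q + symMatrix s' p' q' = symMatrix (s + s') (p + p') (q + q') := by
  ext i j
  fin_cases i <;> fin_cases j <;> simp [symMatrix] <;> ring

theorem symMatrix_sub (s p q s' p' q' : ℝ) :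
    symMatrix s p q - symMatrix s' p' q' = symMatrix (s - s') (p - p') (q - q') := by
  ext i j
  fin_cases i <;> fin_cases j <;> simp [symMatrix] <;> ring

open scoped Matrix.Norms.Operator

theorem norm_symMatrix_le (s p q : ℝ) : ‖symMatrix s p q‖ ≤ |s| + |p| + |q| := by
  apply norm_le_of_rows
  intro i
  have h1 := abs_add_le s p
  have h2 := abs_sub s p
  fin_cases i <;> simp [symMatrix, -Complex.ofReal_add, -Complex.ofReal_sub] <;> linarith

/-- Splitting into the identity, the oscillating part of size `1 / n`, and a part of size
`1 / n² + r n`, uniformly in `ε`. -/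
theorem modelMatrix_eq_one_add {β : ℝ} (R : ℕ → ℝ → Mat2) (n : ℕ) (ε : ℝ) :
    modelMatrix β R n ε = 1 + symMatrix (-β * cosIntegral ε n (n + 1))
        (β * (Real.cos (ε * n) / n)) (β * (Real.sin (ε * n) / n)) +
      (symMatrix (stepFactor β n ε - 1 + β * cosIntegral ε n (n + 1))
        ((stepFactor β n ε - 1) * (β * (Real.cos (ε * n) / n)))
        ((stepFactor β n ε - 1) * (β * (Real.sin (ε * n) / n))) +
        ((stepFactor β n ε : ℝ) : ℂ) • R n ε) := by
  rw [modelMatrix_eq, ← add_assoc, add_assoc (1 : Mat2), symMatrix_add]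
  congr 1
  ext i j
  fin_cases i <;> fin_cases j <;> simp [symMatrix] <;> ring

/-- The near-identity correction that removes the oscillating part of `modelMatrix`. -/
def corrector (β ε : ℝ) (n : ℕ) : Mat2 :=
  symMatrix (-β * (Real.sin (ε * n) / (ε * n))) (β * (abelPrimitive ε n).re)
    (β * (abelPrimitive ε n).im)

theorem norm_corrector_le {β : ℝ} (hβ : 0 ≤ β) {ε γ : ℝ} (hγ : 1 / |ε| ≤ γ)
    (hγ' : 1 / ‖Complex.exp (ε * Complex.I) - 1‖ ≤ γ) (n : ℕ) :
    ‖corrector β ε n‖ ≤ 3 * β * (γ / n) := by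
  refine (norm_symMatrix_le _ _ _).trans ?_
  have h0 : (0 : ℝ) ≤ n := by positivity
  have hg := (norm_abelPrimitive_le ε n).trans (div_le_div_of_nonneg_right hγ' h0)
  have h1 := (Complex.abs_re_le_norm _).trans hg
  have h2 := (Complex.abs_im_le_norm _).trans hg
  have h3 : |Real.sin (ε * n) / (ε * n)| ≤ γ / n := by
    rw [abs_div, abs_mul, Nat.abs_cast, ← div_div]
    refine div_le_div_of_nonneg_right (le_trans ?_ hγ) h0
    exact div_le_div_of_nonneg_right (Real.abs_sin_le_one _) (abs_nonneg _)
  rw [abs_mul, abs_mul, abs_mul, abs_neg, abs_of_nonneg hβ]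
  nlinarith

theorem norm_sub_corrector_diff_le {β : ℝ} (hβ : 0 ≤ β) {ε γ : ℝ} (hε : ε ≠ 0)
    (hε' : Complex.exp (ε * Complex.I) ≠ 1) (hγ : 1 / |ε| ≤ γ)
    (hγ' : 1 / ‖Complex.exp (ε * Complex.I) - 1‖ ≤ γ) {n : ℕ} (hn : 1 ≤ n) :
    ‖symMatrix (-β * cosIntegral ε n (n + 1)) (β * (Real.cos (ε * n) / n))
        (β * (Real.sin (ε * n) / n)) - (corrector β ε (n + 1) - corrector β ε n)‖ ≤
      3 * β * (γ / n ^ 2) := by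
  have hp : (0 : ℝ) < n := by exact_mod_cast hn
  unfold corrector
  rw [symMatrix_sub, symMatrix_sub]
  refine (norm_symMatrix_le _ _ _).trans ?_
  have hg := (norm_sub_abelPrimitive_diff_le hε' hn).trans
    (div_le_div_of_nonneg_right hγ' (by positivity))
  have h1 := (Complex.abs_re_le_norm _).trans hg
  have h2 := (Complex.abs_im_le_norm _).trans hg
  have h3 := (abs_cosIntegral_sub_diff_le hε hp).trans
    (div_le_div_of_nonneg_right hγ (by positivity))
  have ere : (Complex.exp (ε * Complex.I) ^ n / n).re = Real.cos (ε * n) / n := by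
    rw [exp_mul_I_pow, Complex.div_natCast_re]; simp [-Complex.ofReal_cos, -Complex.ofReal_sin]
  have eim : (Complex.exp (ε * Complex.I) ^ n / n).im = Real.sin (ε * n) / n := by
    rw [exp_mul_I_pow, Complex.div_natCast_im]; simp [-Complex.ofReal_cos, -Complex.ofReal_sin]
  rw [Complex.sub_re, Complex.sub_re, ere] at h1
  rw [Complex.sub_im, Complex.sub_im, eim] at h2
  push_cast
  have f1 : ∀ a b c : ℝ, |-β * a - (-β * b - -β * c)| = β * |a - (b - c)| := fun a b c => by
    rw [← abs_of_nonneg hβ, ← abs_mul, abs_of_nonneg hβ, ← abs_neg]; congr 1; ring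
  have f2 : ∀ a b c : ℝ, |β * a - (β * b - β * c)| = β * |a - (b - c)| := fun a b c => by
    rw [← abs_of_nonneg hβ, ← abs_mul, abs_of_nonneg hβ]; congr 1; ring
  rw [f1, f2, f2]
  nlinarith

variable {β : ℝ} {U : Set ℝ} {R : ℕ → ℝ → Mat2} {r : ℕ → ℝ}

/-- Away from `ε = 0`, solutions are almost constant from index `N` on as soon as `N` is large
compared with `1 / |ε|` and `1 / |exp (i ε) - 1|`. -/
theorem ModelHyp.exists_norm_sub_le (H : ModelHyp β U R r) : ∃ C : ℝ, 0 < C ∧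
    ∀ ε ∈ U, ε ≠ 0 → Complex.exp (ε * Complex.I) ≠ 1 → ∀ γ : ℝ, 1 ≤ γ → 1 / |ε| ≤ γ →
      1 / ‖Complex.exp (ε * Complex.I) - 1‖ ≤ γ → ∀ N : ℕ, 1 ≤ N →
      C * (γ / N + ∑' k, r (k + N)) ≤ 1 → ∀ (f : Vec2) (n : ℕ), N ≤ n →
      ‖modelSol β R ε f n - modelSol β R ε f N‖ ≤
        C * (γ / N + ∑' k, r (k + N)) * ‖modelSol β R ε f N‖ := by
  have hβ := H.nonneg
  set E := Real.exp β
  have hE : 0 < E := Real.exp_pos _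
  set K := 3 * β + 9 * β ^ 2 + 2 * (3 * β ^ 2 * E + 2 * E) with hK
  have hK0 : 0 < K := by positivity
  refine ⟨25 * (2 * K + 3 * β), by positivity, ?_⟩
  intro ε hεU hε hε' γ hγ1 hγ hγ' N hN hsmall f n hn
  set T := ∑' k, r (k + N) with hT
  have hT0 : 0 ≤ T := tsum_nonneg fun k => H.majorant_nonneg _
  have hNp : (0 : ℝ) < N := by exact_mod_cast hN
  have hgN : 0 ≤ γ / N := by positivity
  have hsum : ∀ n, ∑ m ∈ Finset.Ico N n, K * (γ * (1 / (m : ℝ) ^ 2) + r m) ≤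
      K * (2 * (γ / N) + T) := by
    intro n
    rw [← Finset.mul_sum, Finset.sum_add_distrib, ← Finset.mul_sum]
    have h1 := sum_Ico_inv_sq_le (n := n) hN
    have h2 : ∑ m ∈ Finset.Ico N n, r m ≤ T := by
      rw [Finset.sum_Ico_eq_sum_range]
      simp_rw [add_comm N]
      exact ((summable_nat_add_iff N).2 H.summable).sum_le_tsum _
        fun i _ => H.majorant_nonneg _
    have h3 : γ * ∑ m ∈ Finset.Ico N n, 1 / (m : ℝ) ^ 2 ≤ 2 * (γ / N) := by
      calc _ ≤ γ * (2 / N) := by gcongr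
        _ = _ := by ring
    gcongr
  have hβγ : 0 ≤ β * (γ / N) := by positivity
  have hKT : 0 ≤ K * T := by positivity
  have hKg : 0 ≤ K * (γ / N) := by positivity
  have hβT : 0 ≤ β * T := by positivity
  have hGN : 3 * β * (γ / N) ≤ 1 / 2 := by nlinarith
  have hG : ∀ n, N ≤ n → ‖corrector β ε n‖ ≤ 3 * β * (γ / N) := fun n hn => by
    refine (norm_corrector_le hβ hγ hγ' n).trans ?_
    have : (N : ℝ) ≤ n := by exact_mod_cast hn
    gcongr
  have main := norm_sub_le_of_near_identity (u := modelSol β R ε f)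
    (v := fun n => (1 - corrector β ε n).mulVec (modelSol β R ε f n)) (N := N)
    (γ := 3 * β * (γ / N)) (τ := K * (2 * (γ / N) + T))
    (η := fun m => K * (γ * (1 / (m : ℝ) ^ 2) + r m)) hGN ?_ ?_ ?_ hsum (by nlinarith) n hn
  · refine main.trans (mul_le_mul_of_nonneg_right ?_ (norm_nonneg _))
    nlinarith
  · intro n hn
    have e : modelSol β R ε f n - (1 - corrector β ε n).mulVec (modelSol β R ε f n) =
        (corrector β ε n).mulVec (modelSol β R ε f n) := by
      rw [Matrix.sub_mulVec, Matrix.one_mulVec, sub_sub_cancel]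
    rw [e]
    exact (Matrix.linfty_opNorm_mulVec _ _).trans
      (mul_le_mul_of_nonneg_right (hG n hn) (norm_nonneg _))
  · intro n _
    have := H.majorant_nonneg n
    positivity
  · intro n hn
    have hn1 : 1 ≤ n := hN.trans hn
    have h1n : (1 : ℝ) ≤ n := by exact_mod_cast hn1
    have hp : (0 : ℝ) < n := by linarith
    have hrn := H.majorant_nonneg n
    set A := symMatrix (-β * cosIntegral ε n (n + 1)) (β * (Real.cos (ε * n) / n))
        (β * (Real.sin (ε * n) / n)) with hA
    set S := symMatrix (stepFactor β n ε - 1 + β * cosIntegral ε n (n + 1))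
        ((stepFactor β n ε - 1) * (β * (Real.cos (ε * n) / n)))
        ((stepFactor β n ε - 1) * (β * (Real.sin (ε * n) / n))) +
        ((stepFactor β n ε : ℝ) : ℂ) • R n ε with hS
    set G := corrector β ε (n + 1) with hGdef
    have e : (1 - G).mulVec (modelSol β R ε f (n + 1)) -
        (1 - corrector β ε n).mulVec (modelSol β R ε f n) =
        ((A - (G - corrector β ε n)) + S - G * A - G * S).mulVec (modelSol β R ε f n) := by
      rw [modelSol_succ β R ε f hn1, Matrix.mulVec_mulVec, ← Matrix.sub_mulVec,
        modelMatrix_eq_one_add, ← hA, ← hS]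
      congr 1
      noncomm_ring
    rw [e]
    refine (Matrix.linfty_opNorm_mulVec _ _).trans
      (mul_le_mul_of_nonneg_right ?_ (norm_nonneg _))
    have hcos : |Real.cos (ε * n) / n| ≤ 1 / n := by
      rw [abs_div, abs_of_pos hp]
      exact div_le_div_of_nonneg_right (Real.abs_cos_le_one _) hp.le
    have hsin : |Real.sin (ε * n) / n| ≤ 1 / n := by
      rw [abs_div, abs_of_pos hp]
      exact div_le_div_of_nonneg_right (Real.abs_sin_le_one _) hp.le
    have hAn : ‖A‖ ≤ 3 * β * (1 / n) := by
      refine (norm_symMatrix_le _ _ _).trans ?_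
      have := abs_cosIntegral_succ_le ε hn1
      rw [abs_mul, abs_mul, abs_mul, abs_neg, abs_of_nonneg hβ]
      nlinarith
    have hSn : ‖S‖ ≤ (3 * β ^ 2 * E) * (1 / n ^ 2) + 2 * E * r n := by
      refine (norm_add_le _ _).trans (add_le_add ?_ ?_)
      · refine (norm_symMatrix_le _ _ _).trans ?_
        have h1 := abs_stepFactor_sub_le hβ ε hn1
        have h2 := abs_stepFactor_sub_one_le hβ ε hn1
        have h3 : ∀ d : ℝ, |d| ≤ 1 / n →
            |(stepFactor β n ε - 1) * (β * d)| ≤ β ^ 2 * E * (1 / n ^ 2) := fun d hd => by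
          rw [abs_mul, abs_mul, abs_of_nonneg hβ]
          calc _ ≤ (β * E / n) * (β * (1 / n)) := by gcongr
            _ = _ := by field_simp
        have h4 := h3 _ hcos
        have h5 := h3 _ hsin
        have h6 : β ^ 2 * E / n ^ 2 = β ^ 2 * E * (1 / n ^ 2) := by ring
        rw [h6] at h1
        linarith
      · refine (norm_le_of_entries (c := E * r n) fun i j => ?_).trans_eq (by ring)
        rw [Matrix.smul_apply, smul_eq_mul, norm_mul, Complex.norm_real, Real.norm_eq_abs,
          abs_of_pos (stepFactor_pos β n ε)]
        exact mul_le_mul (stepFactor_le hβ ε hn1) (H.entry_le n hn1 ε hεU i j) (norm_nonneg _)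
          hE.le
    have hGA : ‖G‖ ≤ 3 * β * (γ / n) := by
      refine (norm_corrector_le hβ hγ hγ' (n + 1)).trans ?_
      gcongr
      linarith
    have hGh : ‖G‖ ≤ 1 := (hG (n + 1) (by omega)).trans (by linarith)
    have hD := norm_sub_corrector_diff_le hβ hε hε' hγ hγ' hn1
    rw [← hA, ← hGdef] at hD
    have hGA' : ‖G * A‖ ≤ 9 * β ^ 2 * (γ * (1 / n ^ 2)) := by
      refine (norm_mul_le _ _).trans ?_
      calc _ ≤ (3 * β * (γ / n)) * (3 * β * (1 / n)) := by gcongr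
        _ = _ := by field_simp; ring
    have hGS : ‖G * S‖ ≤ ‖S‖ :=
      (norm_mul_le _ _).trans (mul_le_of_le_one_left (norm_nonneg _) hGh)
    have htri : ‖(A - (G - corrector β ε n)) + S - G * A - G * S‖ ≤
        ‖A - (G - corrector β ε n)‖ + ‖S‖ + ‖G * A‖ + ‖G * S‖ := by
      refine (norm_sub_le _ _).trans (add_le_add_left ?_ _)
      refine (norm_sub_le _ _).trans (add_le_add_left ?_ _)
      exact norm_add_le _ _
    have hq : (0 : ℝ) ≤ 1 / n ^ 2 := by positivity
    have hγq : 1 / (n : ℝ) ^ 2 ≤ γ * (1 / n ^ 2) := le_mul_of_one_le_left hq hγ1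
    have h7 : γ / (n : ℝ) ^ 2 = γ * (1 / n ^ 2) := by ring
    rw [h7] at hD
    set Q := γ * (1 / (n : ℝ) ^ 2) with hQ
    have hQ0 : 0 ≤ Q := by positivity
    have h8 : 3 * β ^ 2 * E * (1 / (n : ℝ) ^ 2) ≤ 3 * β ^ 2 * E * Q := by gcongr
    have h9 : 0 ≤ E * Q := by positivity
    have h10 : 0 ≤ (3 * β + 9 * β ^ 2 + 6 * β ^ 2 * E) * r n := by positivity
    rw [hK]
    nlinarith

end

/-! ### Interchange of limits and the rank -/

noncomputable section

variable {β : ℝ} {U : Set ℝ} {R : ℕ → ℝ → Mat2} {r : ℕ → ℝ}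

theorem modelSol_add (β : ℝ) (R : ℕ → ℝ → Mat2) (ε : ℝ) (f g : Vec2) (n : ℕ) :
    modelSol β R ε (f + g) n = modelSol β R ε f n + modelSol β R ε g n := by
  rcases Nat.eq_zero_or_pos n with rfl | hn
  · simp [modelSol]
  induction n, hn using Nat.le_induction with
  | base => simp [modelSol]
  | succ n hn ih =>
    rw [modelSol_succ β R ε _ hn, modelSol_succ β R ε _ hn, modelSol_succ β R ε _ hn, ih,
      Matrix.mulVec_add]

theorem modelSol_smul (β : ℝ) (R : ℕ → ℝ → Mat2) (ε : ℝ) (c : ℂ) (f : Vec2) (n : ℕ) :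
    modelSol β R ε (c • f) n = c • modelSol β R ε f n := by
  rcases Nat.eq_zero_or_pos n with rfl | hn
  · simp [modelSol]
  induction n, hn using Nat.le_induction with
  | base => simp [modelSol]
  | succ n hn ih =>
    rw [modelSol_succ β R ε _ hn, modelSol_succ β R ε _ hn, ih, Matrix.mulVec_smul]

/-- The map `f ↦ lim_n u_n(0, f)`. -/
def ModelHyp.limitMap (H : ModelHyp β U R r) : Vec2 →ₗ[ℂ] Vec2 where
  toFun := slowConst β R
  map_add' f g := tendsto_nhds_unique (H.tendsto_modelSol_zero (f + g))
    (((H.tendsto_modelSol_zero f).add (H.tendsto_modelSol_zero g)).congr fun n =>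
      (modelSol_add β R 0 f g n).symm)
  map_smul' c f := tendsto_nhds_unique (H.tendsto_modelSol_zero (c • f))
    (((H.tendsto_modelSol_zero f).const_smul c).congr fun n => (modelSol_smul β R 0 c f n).symm)

theorem exp_mul_I_ne_one {ε : ℝ} (hε : ε ≠ 0) (h : ε ∈ Set.Ioo (-(2 * Real.pi)) (2 * Real.pi)) :
    Complex.exp (ε * Complex.I) ≠ 1 := by
  intro h1
  obtain ⟨n, hn⟩ := Complex.exp_eq_one_iff.1 h1
  have h2 : ε = n * (2 * Real.pi) := by
    have := congrArg Complex.im hn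
    simpa using this
  have hpi := Real.two_pi_pos
  have h3 : (n : ℝ) < 1 := by
    by_contra hge
    push Not at hge
    nlinarith [h.2]
  have h4 : (-1 : ℝ) < n := by
    by_contra hge
    push Not at hge
    nlinarith [h.1]
  have h5 : n = 0 := by
    have h3' : n < 1 := by exact_mod_cast h3
    have h4' : -1 < n := by exact_mod_cast h4
    omega
  rw [h5] at h2
  simp at h2
  exact hε h2

theorem ModelHyp.exists_tendsto_modelSol (H : ModelHyp β U R r)
    (hU : U ⊆ Set.Ioo (-(2 * Real.pi)) (2 * Real.pi)) {ε : ℝ} (hε : ε ∈ U) (f : Vec2) :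
    ∃ a, Tendsto (modelSol β R ε f) atTop (𝓝 a) := by
  rcases eq_or_ne ε 0 with rfl | h0
  · exact ⟨_, H.tendsto_modelSol_zero f⟩
  obtain ⟨C, hC, h⟩ := H.exists_norm_sub_le
  have h1 := exp_mul_I_ne_one h0 (hU hε)
  set γ := max 1 (max (1 / |ε|) (1 / ‖Complex.exp (ε * Complex.I) - 1‖)) with hγ
  have h2 := h ε hε h0 h1 γ (le_max_left _ _) ((le_max_left _ _).trans (le_max_right _ _))
    ((le_max_right _ _).trans (le_max_right _ _))
  have ht : Tendsto (fun N : ℕ => C * (γ / N + ∑' k, r (k + N))) atTop (𝓝 0) := by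
    simpa using ((tendsto_const_div_atTop_nhds_zero_nat γ).add (tendsto_sum_nat_add r)).const_mul C
  obtain ⟨N₀, hN₀⟩ := eventually_atTop.1
    ((ht.eventually_le_const one_pos).and (eventually_ge_atTop 1))
  set B := 2 * ‖modelSol β R ε f N₀‖ with hB
  have hbound : ∀ n, N₀ ≤ n → ‖modelSol β R ε f n‖ ≤ B := fun n hn => by
    have h3 := h2 N₀ (hN₀ N₀ le_rfl).2 (hN₀ N₀ le_rfl).1 f n hn
    have h4 := mul_le_mul_of_nonneg_right (hN₀ N₀ le_rfl).1 (norm_nonneg (modelSol β R ε f N₀))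
    have h5 := norm_add_le (modelSol β R ε f n - modelSol β R ε f N₀) (modelSol β R ε f N₀)
    rw [sub_add_cancel] at h5
    linarith
  refine cauchySeq_tendsto_of_complete (Metric.cauchySeq_iff'.2 fun e he => ?_)
  have htB : Tendsto (fun N : ℕ => C * (γ / N + ∑' k, r (k + N)) * B) atTop (𝓝 0) := by
    simpa using ht.mul_const B
  obtain ⟨N, hN1, hN2⟩ := ((htB.eventually_lt_const he).and (eventually_ge_atTop N₀)).exists
  refine ⟨N, fun n hn => ?_⟩
  rw [dist_eq_norm]
  refine (h2 N (hN₀ N hN2).2 (hN₀ N hN2).1 f n hn).trans_lt (lt_of_le_of_lt ?_ hN1)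
  refine mul_le_mul_of_nonneg_left (hbound N hN2) ?_
  have h0γ : 0 ≤ γ := le_trans zero_le_one (le_max_left _ _)
  have : 0 ≤ ∑' k, r (k + N) := tsum_nonneg fun k => H.majorant_nonneg _
  positivity

theorem half_abs_le_norm_exp_sub_one {ε : ℝ} (h : |ε| ≤ 1) :
    |ε| / 2 ≤ ‖Complex.exp (ε * Complex.I) - 1‖ := by
  have h1 : |Real.sin ε| ≤ ‖Complex.exp (ε * Complex.I) - 1‖ := by
    have h2 := Complex.abs_im_le_norm (Complex.exp (ε * Complex.I) - 1)
    rwa [Complex.sub_im, Complex.one_im, sub_zero, Complex.exp_ofReal_mul_I_im] at h2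
  have h3 := Real.mul_abs_le_abs_sin (x := ε) (by linarith [Real.pi_gt_three])
  have h4 : 1 / 2 ≤ 2 / Real.pi := by
    rw [div_le_div_iff₀ two_pos Real.pi_pos]
    linarith [Real.pi_le_four]
  nlinarith [abs_nonneg ε]

/-- On the scale `n ≥ y / |ε|` the solution is within `O (1 / y)` of its limit, uniformly for small
`ε`; hence the limits `ε → 0` and `y → ∞` may be interchanged. -/
theorem ModelHyp.eventually_norm_sub_le (H : ModelHyp β U R r)
    (hU : U ⊆ Set.Ioo (-(2 * Real.pi)) (2 * Real.pi)) (f : Vec2) {l : Filter ℝ} [l.NeBot]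
    (hl : l ≤ 𝓝[≠] 0) {v : ℝ → Vec2}
    (hv : ∀ ε ∈ U, Tendsto (modelSol β R ε f) atTop (𝓝 (v ε))) {h : ℝ → Vec2}
    (hh : ∀ y, 0 < y → Tendsto (fun ε : ℝ => modelSol β R ε f ⌊y / |ε|⌋₊) l (𝓝 (h y))) :
    ∃ K y₀ : ℝ, 0 < y₀ ∧ ∀ y, y₀ ≤ y → ∀ᶠ ε in l, ‖v ε - h y‖ ≤ K / y := by
  obtain ⟨C, hC, hsub⟩ := H.exists_norm_sub_le
  have hε0 : Tendsto (fun ε : ℝ => ε) l (𝓝 0) := (tendsto_id.mono_left hl).mono_right inf_le_left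
  have hne : ∀ᶠ ε in l, ε ≠ 0 := hl self_mem_nhdsWithin
  have habs : Tendsto (fun ε : ℝ => |ε|) l (𝓝 0) := by simpa using hε0.abs
  have hx : ∀ y : ℝ, 0 < y → Tendsto (fun ε : ℝ => y / |ε|) l atTop := fun y hy => by
    have h1 : Tendsto (fun ε : ℝ => |ε|) l (𝓝[>] 0) :=
      tendsto_nhdsWithin_iff.2 ⟨habs, hne.mono fun ε h => abs_pos.2 h⟩
    simpa [div_eq_mul_inv] using h1.inv_tendsto_nhdsGT_zero.const_mul_atTop hy
  -- the estimate from index `⌊y / |ε|⌋` on, relative to the size of the solution there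
  have hrel : ∀ y, 5 * C ≤ y → ∀ᶠ ε in l, ∀ n, ⌊y / |ε|⌋₊ ≤ n →
      ‖modelSol β R ε f n - modelSol β R ε f ⌊y / |ε|⌋₊‖ ≤
        5 * C / y * ‖modelSol β R ε f ⌊y / |ε|⌋₊‖ := by
    intro y hy
    have hy0 : 0 < y := lt_of_lt_of_le (by positivity) hy
    have hN : Tendsto (fun ε : ℝ => ⌊y / |ε|⌋₊) l atTop := tendsto_nat_floor_atTop.comp (hx y hy0)
    have htail := (tendsto_sum_nat_add r).comp hN
    filter_upwards [hne, habs.eventually_le_const one_pos, (hx y hy0).eventually_ge_atTop 2,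
      hN.eventually_ge_atTop 1, hε0.eventually H.mem_nhds,
      htail.eventually_le_const (one_div_pos.2 hy0)] with ε h0 h1 h2 h3 hεU h4 n hn
    have hεp : 0 < |ε| := abs_pos.2 h0
    have hNp : (0 : ℝ) < ⌊y / |ε|⌋₊ := by exact_mod_cast h3
    have hNlow : y / |ε| / 2 ≤ ⌊y / |ε|⌋₊ := by linarith [Nat.lt_floor_add_one (y / |ε|)]
    have hγN : 2 / |ε| / ⌊y / |ε|⌋₊ ≤ 4 / y := by
      rw [div_le_div_iff₀ hNp hy0]
      calc 2 / |ε| * y = 4 * (y / |ε| / 2) := by ring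
        _ ≤ _ := by gcongr
    have hsmall : C * (2 / |ε| / ⌊y / |ε|⌋₊ + ∑' k, r (k + ⌊y / |ε|⌋₊)) ≤ 5 * C / y := by
      have h4' : ∑' k, r (k + ⌊y / |ε|⌋₊) ≤ 1 / y := h4
      calc _ ≤ C * (4 / y + 1 / y) := by gcongr
        _ = _ := by ring
    have h5 : 5 * C / y ≤ 1 := (div_le_one hy0).2 hy
    have hexp := half_abs_le_norm_exp_sub_one h1
    have h6 := hsub ε hεU h0 (exp_mul_I_ne_one h0 (hU hεU)) (2 / |ε|)
      (by rw [le_div_iff₀ hεp]; linarith) (by gcongr; norm_num)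
      (by
        calc 1 / ‖Complex.exp (ε * Complex.I) - 1‖ ≤ 1 / (|ε| / 2) :=
              one_div_le_one_div_of_le (by positivity) hexp
          _ = 2 / |ε| := by field_simp) ⌊y / |ε|⌋₊ h3 (hsmall.trans h5) f n hn
    exact h6.trans (mul_le_mul_of_nonneg_right hsmall (norm_nonneg _))
  set y₀ := 5 * C with hy₀
  have hy₀p : 0 < y₀ := by positivity
  set B := 2 * (‖h y₀‖ + 1) with hB
  have hbound : ∀ᶠ ε in l, ∀ n, ⌊y₀ / |ε|⌋₊ ≤ n → ‖modelSol β R ε f n‖ ≤ B := by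
    filter_upwards [hrel y₀ le_rfl, (hh y₀ hy₀p).norm.eventually_le_const (lt_add_one _)] with
      ε h1 h2 n hn
    have h3 := h1 n hn
    rw [div_self hy₀p.ne', one_mul] at h3
    have h5 := norm_add_le (modelSol β R ε f n - modelSol β R ε f ⌊y₀ / |ε|⌋₊)
      (modelSol β R ε f ⌊y₀ / |ε|⌋₊)
    rw [sub_add_cancel] at h5
    linarith
  refine ⟨5 * C * B + 1, y₀, hy₀p, fun y hy => ?_⟩
  have hy0 : 0 < y := hy₀p.trans_le hy
  have hclose : ∀ᶠ ε in l, ‖modelSol β R ε f ⌊y / |ε|⌋₊ - h y‖ ≤ 1 / y := by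
    have := tendsto_iff_norm_sub_tendsto_zero.1 (hh y hy0)
    exact this.eventually_le_const (one_div_pos.2 hy0)
  filter_upwards [hrel y hy, hbound, hclose, hε0.eventually H.mem_nhds] with ε h1 h2 h3 hεU
  have hN : ‖modelSol β R ε f ⌊y / |ε|⌋₊‖ ≤ B :=
    h2 _ (Nat.floor_mono (div_le_div_of_nonneg_right hy (abs_nonneg _)))
  have h4 : ‖v ε - modelSol β R ε f ⌊y / |ε|⌋₊‖ ≤ 5 * C / y * B := by
    refine le_of_tendsto ((hv ε hεU).sub_const _).norm ?_
    filter_upwards [eventually_ge_atTop ⌊y / |ε|⌋₊] with n hn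
    exact (h1 n hn).trans (by gcongr)
  calc ‖v ε - h y‖ ≤ ‖v ε - modelSol β R ε f ⌊y / |ε|⌋₊‖ +
        ‖modelSol β R ε f ⌊y / |ε|⌋₊ - h y‖ := by
        simpa using norm_add_le (v ε - modelSol β R ε f ⌊y / |ε|⌋₊)
          (modelSol β R ε f ⌊y / |ε|⌋₊ - h y)
    _ ≤ 5 * C / y * B + 1 / y := add_le_add h4 h3
    _ = _ := by ring

/-- Interchange of limits from a uniform rate. -/
theorem exists_common_limit {l : Filter ℝ} [l.NeBot] {v h : ℝ → Vec2} {K y₀ : ℝ}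
    (hK : ∀ y, y₀ ≤ y → ∀ᶠ ε in l, ‖v ε - h y‖ ≤ K / y) :
    ∃ a, Tendsto v l (𝓝 a) ∧ Tendsto h atTop (𝓝 a) := by
  have ht : Tendsto (fun y : ℝ => K / y) atTop (𝓝 0) := tendsto_const_nhds.div_atTop tendsto_id
  have hc : ∃ a, Tendsto v l (𝓝 a) := by
    rw [← cauchy_map_iff_exists_tendsto, Metric.cauchy_iff]
    refine ⟨inferInstance, fun e he => ?_⟩
    obtain ⟨y, hy1, hy2⟩ :=
      ((ht.eventually_lt_const (half_pos he)).and (eventually_ge_atTop y₀)).exists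
    refine ⟨Metric.closedBall (h y) (K / y), ?_, fun a ha b hb => ?_⟩
    · refine mem_map.2 ((hK y hy2).mono fun ε hε => ?_)
      rwa [Metric.mem_closedBall, dist_eq_norm]
    · calc dist a b ≤ dist a (h y) + dist b (h y) := dist_triangle_right _ _ _
        _ < e := by linarith [Metric.mem_closedBall.1 ha, Metric.mem_closedBall.1 hb]
  obtain ⟨a, ha⟩ := hc
  refine ⟨a, ha, tendsto_iff_norm_sub_tendsto_zero.2 (squeeze_zero' (Eventually.of_forall
    fun _ => norm_nonneg _) ?_ ht)⟩
  filter_upwards [eventually_ge_atTop y₀] with y hy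
  rw [norm_sub_rev]
  exact le_of_tendsto (ha.sub_const _).norm (hK y hy)

theorem exists_modelSol_eq (hinv : ∀ n : ℕ, 1 ≤ n → IsUnit (modelMatrix β R n 0)) {N : ℕ}
    (hN : 1 ≤ N) (w : Vec2) : ∃ f, modelSol β R 0 f N = w := by
  induction N, hN using Nat.le_induction generalizing w with
  | base => exact ⟨w, rfl⟩
  | succ N hN ih =>
    obtain ⟨v, hv⟩ := Matrix.mulVec_surjective_iff_isUnit.2 (hinv N hN) w
    obtain ⟨f, hf⟩ := ih v
    exact ⟨f, by rw [modelSol_succ β R 0 f hN, hf, hv]⟩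

theorem comparisonMatrix_zero_mulVec (β : ℝ) (n : ℕ) (v : Vec2) :
    (comparisonMatrix β n 0).mulVec v = scaleSnd (weight β 0 n (n + 1)) v := by
  ext i
  fin_cases i <;> simp [comparisonMatrix, weight, dotProduct, Fin.sum_univ_two]

/-- A solution at `ε = 0` that starts late from `(1, 0)` keeps its first component near `1`. -/
theorem ModelHyp.exists_limitMap_apply_zero_ne (H : ModelHyp β U R r)
    (hinv : ∀ n : ℕ, 1 ≤ n → IsUnit (modelMatrix β R n 0)) : ∃ f, H.limitMap f 0 ≠ 0 := by
  obtain ⟨C, hC, hS⟩ := norm_stepRemainder_mulVec_le H le_rfl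
  have h0U : (0 : ℝ) ∈ U := mem_of_mem_nhds H.mem_nhds
  have ht : Tendsto (fun N : ℕ => C * (2 / (N : ℝ) + ∑' k, r (k + N))) atTop (𝓝 0) := by
    simpa using ((tendsto_const_div_atTop_nhds_zero_nat 2).add (tendsto_sum_nat_add r)).const_mul C
  obtain ⟨N, hNs, hN⟩ := ((ht.eventually_le_const (u := 1 / 4) (by norm_num)).and
    (eventually_ge_atTop 1)).exists
  set η : ℕ → ℝ := fun m => C * (1 / (m : ℝ) ^ 2 + r m) with hη
  have hη0 : ∀ m, 0 ≤ η m := fun m => by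
    have := H.majorant_nonneg m
    positivity
  have hsum : ∀ n, ∑ m ∈ Finset.Ico N n, η m ≤ 1 / 4 := by
    intro n
    refine le_trans ?_ hNs
    rw [hη, ← Finset.mul_sum, Finset.sum_add_distrib]
    refine mul_le_mul_of_nonneg_left (add_le_add (sum_Ico_inv_sq_le hN) ?_) hC
    rw [Finset.sum_Ico_eq_sum_range]
    simp_rw [add_comm N]
    exact ((summable_nat_add_iff N).2 H.summable).sum_le_tsum _ fun i _ => H.majorant_nonneg _
  obtain ⟨f, hf⟩ := exists_modelSol_eq hinv hN ![1, 0]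
  have hfn : ‖modelSol β R 0 f N‖ ≤ 1 := by
    rw [hf, pi_norm_le_iff_of_nonneg zero_le_one]
    intro i
    fin_cases i <;> simp
  have hstep : ∀ n, N ≤ n → modelSol β R 0 f (n + 1) =
      scaleSnd (weight β 0 n (n + 1)) (modelSol β R 0 f n) +
        (stepRemainder β R n 0).mulVec (modelSol β R 0 f n) := by
    intro n hn
    rw [modelSol_succ β R 0 f (hN.trans hn), ← comparisonMatrix_zero_mulVec, ← Matrix.add_mulVec]
    simp [stepRemainder]
  have hSn : ∀ n, N ≤ n → ‖(stepRemainder β R n 0).mulVec (modelSol β R 0 f n)‖ ≤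
      η n * ‖modelSol β R 0 f n‖ := fun n hn => hS 0 h0U n (hN.trans hn) (by simp) _
  have hgrow : ∀ n, N ≤ n → ‖modelSol β R 0 f n‖ ≤ 3 := by
    intro n hn
    have h := le_exp_sum_mul (a := fun m => ‖modelSol β R 0 f m‖) (η := η) hn (by
      intro m hm _
      have hmp : (0 : ℝ) < m := by exact_mod_cast hN.trans hm
      have hw : |weight β 0 m (m + 1)| ≤ 1 := by
        rw [abs_of_pos (weight_pos _ _ _ _)]
        simpa using weight_le H.nonneg (ε := 0) (Y := 0) hmp (by linarith : (m : ℝ) ≤ m + 1)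
          (by simp)
      rw [hstep m hm]
      have h1 := norm_scaleSnd_le le_rfl hw (modelSol β R 0 f m)
      have h2 := hSn m hm
      have h3 := norm_add_le (scaleSnd (weight β 0 m (m + 1)) (modelSol β R 0 f m))
        ((stepRemainder β R m 0).mulVec (modelSol β R 0 f m))
      have h4 := Real.add_one_le_exp (η m)
      nlinarith [norm_nonneg (modelSol β R 0 f m)])
    have h1 : Real.exp (∑ m ∈ Finset.Ico N n, η m) ≤ Real.exp 1 :=
      Real.exp_le_exp.2 (by linarith [hsum n])
    have h2 := Real.exp_one_lt_d9
    have h3 := Real.exp_pos (∑ m ∈ Finset.Ico N n, η m)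
    nlinarith [norm_nonneg (modelSol β R 0 f N)]
  have hfst : ∀ n, N ≤ n →
      ‖modelSol β R 0 f n 0 - 1‖ ≤ 3 * ∑ m ∈ Finset.Ico N n, η m := by
    intro n hn
    induction n, hn using Nat.le_induction with
    | base => simp [hf]
    | succ n hn ih =>
      rw [Finset.sum_Ico_succ_top hn, hstep n hn, Pi.add_apply, scaleSnd_zero]
      have h1 := (norm_le_pi_norm ((stepRemainder β R n 0).mulVec (modelSol β R 0 f n)) 0).trans
        (hSn n hn)
      have h2 := mul_le_mul_of_nonneg_left (hgrow n hn) (hη0 n)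
      have h3 := norm_add_le (modelSol β R 0 f n 0 - 1)
        ((stepRemainder β R n 0).mulVec (modelSol β R 0 f n) 0)
      rw [sub_add_eq_add_sub] at h3
      linarith
  refine ⟨f, fun h0 => ?_⟩
  have hlim : Tendsto (fun n => modelSol β R 0 f n 0) atTop (𝓝 (H.limitMap f 0)) :=
    tendsto_pi_nhds.1 (H.tendsto_modelSol_zero f) 0
  have h1 : ‖H.limitMap f 0 - 1‖ ≤ 3 / 4 := by
    refine le_of_tendsto (hlim.sub_const 1).norm ?_
    filter_upwards [eventually_ge_atTop N] with n hn
    linarith [hfst n hn, hsum n]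
  rw [h0] at h1
  norm_num at h1

theorem ModelHyp.finrank_range_limitMap (H : ModelHyp β U R r) (hβ : 0 < β)
    (hinv : ∀ n : ℕ, 1 ≤ n → IsUnit (modelMatrix β R n 0)) :
    Module.finrank ℂ (LinearMap.range H.limitMap) = 1 := by
  obtain ⟨f, hf⟩ := H.exists_limitMap_apply_zero_ne hinv
  have h1 : ∀ g, H.limitMap g 1 = 0 := slowConst_apply_one hβ
  refine finrank_eq_one_iff'.2 ⟨⟨H.limitMap f, f, rfl⟩, ?_, ?_⟩
  · intro h
    exact hf (congrFun (congrArg Subtype.val h) 0)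
  · rintro ⟨_, g, rfl⟩
    refine ⟨H.limitMap g 0 / H.limitMap f 0, Subtype.ext ?_⟩
    ext i
    fin_cases i
    · simp [div_mul_cancel₀ _ hf]
    · simp [h1]

/-- The hypotheses with the Euclidean operator norm imply the entrywise ones. -/
theorem exists_modelHyp (hβ : 0 ≤ β) (hUopen : IsOpen U) (hU0 : (0 : ℝ) ∈ U)
    (hRcont : ∀ n : ℕ, 1 ≤ n → ContinuousOn (R n) U) (hRsum : UniformlySummableOn R U) :
    ∃ r, ModelHyp β U R r := by
  obtain ⟨r, hr0, hr, hR⟩ := hRsum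
  exact ⟨r, hβ, hUopen.mem_nhds hU0, fun n => (hr0 n).le, hr,
    fun n hn ε hε i j => norm_entry_le_of_l2 (hR n hn ε hε) i j,
    fun n hn => (hRcont n hn).continuousAt (hUopen.mem_nhds hU0)⟩

end

theorem theorem4p1 (β : ℝ) (hβ : 0 ≤ β) (U : Set ℝ) (hUopen : IsOpen U) (hU0 : (0 : ℝ) ∈ U)
    (hU : U ⊆ Set.Ioo (-(2 * Real.pi)) (2 * Real.pi))
    (R : ℕ → ℝ → Mat2)
    (hRcont : ∀ n : ℕ, 1 ≤ n → ContinuousOn (R n) U)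
    (hinv : ∀ n : ℕ, 1 ≤ n → ∀ ε ∈ U, IsUnit (modelMatrix β R n ε))
    (hRsum : UniformlySummableOn R U) :
    ∃ (uLim : ℝ → Vec2 → Vec2) (Θ : Vec2 →ₗ[ℂ] Vec2),
      -- the limits `lim_n u_n(ε, f)` exist, and `Θ f` is the one at `ε = 0`
      (∀ ε ∈ U, ∀ f : Vec2,
        Tendsto (fun n : ℕ => modelSol β R ε f n) atTop (𝓝 (uLim ε f))) ∧
      (∀ f : Vec2, Θ f = uLim 0 f) ∧
      -- slow-scale limits, their integral equations, and the iterated limits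
      (∀ f : Vec2, ∃ (hPlus hMinus : ℝ → Vec2) (lPlus lMinus : Vec2),
        (∀ y : ℝ, 0 < y →
          Tendsto (fun ε : ℝ => modelSol β R ε f ⌊y / |ε|⌋₊) (𝓝[>] 0) (𝓝 (hPlus y))) ∧
        (∀ y : ℝ, 0 < y →
          Tendsto (fun ε : ℝ => modelSol β R ε f ⌊y / |ε|⌋₊) (𝓝[<] 0) (𝓝 (hMinus y))) ∧
        SolvesSlowEquation β 1 (Θ f) hPlus ∧
        SolvesSlowEquation β (-1) (Θ f) hMinus ∧
        Tendsto (fun ε : ℝ => uLim ε f) (𝓝[>] 0) (𝓝 lPlus) ∧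
        Tendsto hPlus atTop (𝓝 lPlus) ∧
        Tendsto (fun ε : ℝ => uLim ε f) (𝓝[<] 0) (𝓝 lMinus) ∧
        Tendsto hMinus atTop (𝓝 lMinus)) ∧
      -- the rank of `Θ`
      (0 < β → Module.finrank ℂ (LinearMap.range Θ) = 1) := by
  obtain ⟨r, H⟩ := exists_modelHyp hβ hUopen hU0 hRcont hRsum
  have hex : ∀ ε : ℝ, ∀ f : Vec2, ∃ a, ε ∈ U → Tendsto (modelSol β R ε f) atTop (𝓝 a) := by
    intro ε f
    by_cases hε : ε ∈ U
    · obtain ⟨a, ha⟩ := H.exists_tendsto_modelSol hU hε f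
      exact ⟨a, fun _ => ha⟩
    · exact ⟨0, fun h => absurd h hε⟩
  choose uLim huLim using hex
  refine ⟨uLim, H.limitMap, fun ε hε f => huLim ε f hε, fun f =>
    tendsto_nhds_unique (H.tendsto_modelSol_zero f) (huLim 0 f hU0), fun f => ?_,
    fun hβ' => H.finrank_range_limitMap hβ' fun n hn => hinv n hn 0 hU0⟩
  have hgt : 𝓝[>] (0 : ℝ) ≤ 𝓝[≠] 0 := nhdsWithin_mono _ fun x hx => ne_of_gt hx
  have hlt : 𝓝[<] (0 : ℝ) ≤ 𝓝[≠] 0 := nhdsWithin_mono _ fun x hx => ne_of_lt hx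
  have hpos : ∀ᶠ ε : ℝ in 𝓝[>] 0, ε = 1 * |ε| := by
    filter_upwards [self_mem_nhdsWithin] with ε hε
    rw [abs_of_pos hε, one_mul]
  have hneg : ∀ᶠ ε : ℝ in 𝓝[<] 0, ε = -1 * |ε| := by
    filter_upwards [self_mem_nhdsWithin] with ε hε
    rw [abs_of_neg hε]; ring
  obtain ⟨hPlus, hp1, hp2⟩ := H.exists_slow_limit f hgt hpos
  obtain ⟨hMinus, hm1, hm2⟩ := H.exists_slow_limit f hlt hneg
  obtain ⟨_, _, _, hp3⟩ := H.eventually_norm_sub_le hU f hgt (fun ε hε => huLim ε f hε) hp1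
  obtain ⟨_, _, _, hm3⟩ := H.eventually_norm_sub_le hU f hlt (fun ε hε => huLim ε f hε) hm1
  obtain ⟨lPlus, hp4, hp5⟩ := exists_common_limit hp3
  obtain ⟨lMinus, hm4, hm5⟩ := exists_common_limit hm3
  exact ⟨hPlus, hMinus, lPlus, lMinus, hp1, hm1, hp2, hm2, hp4, hp5, hm4, hm5⟩
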